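/- Let $f:(0,\infty)\to\mathbb R$ be a locally integrable function whose Laplace transform $$F(z)=\int_0^\infty e^{-zt}f(t)\,dt$$ exists as a (finite) Lebesgue integral for every $z>0$. For $n\ge 1$ and $x>0$ define the Gaver–Stehfest approximations $$f_n(x)=\frac{\ln 2}{x}\sum_{k=1}^{2n}a_k(n)\,F\!\left(\frac{k\ln 2}{x}\right),\qquad a_k(n)=\frac{(-1)^{n+k}}{n!}\sum_{j=\lfloor (k+1)/2\rfloor}^{\min(k,n)} j^{\,n+1}\binom nj\binom{2j}{j}\binom{j}{k-j}.$$ Let $x>0$ and suppose that for some $\alpha>0$ $$f(x+v)-f(x)=O(|v|^\alpha)\qquad (v\to 0),$$ i.e. there are $C,\delta>0$ with $|f(x+v)-f(x)|\le C|v|^\alpha$ whenever $|v|<\delta$. Then $f_n(x)\to f(x)$ as $n\to\infty$. -/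

import Mathlib

open MeasureTheory Set Filter Topology Asymptotics

/-- The Laplace transform `F(z) = ∫_0^∞ e^{-z t} f(t) dt` of a function on `(0, ∞)`;
only the values of `f` on `(0, ∞)` matter. -/
noncomputable def laplaceTransform (f : ℝ → ℝ) (z : ℝ) : ℝ :=
  ∫ t in Ioi (0 : ℝ), Real.exp (-z * t) * f t

/-- The Gaver–Stehfest coefficient `a_k(n)`, for `n ≥ 1` and `1 ≤ k ≤ 2n`.  The lower summation
limit is the integer part of `(k+1)/2`; every index satisfies `j ≤ k`, so `k - j` is the
ordinary difference. -/
noncomputable def gaverStehfestCoeff (n k : ℕ) : ℝ :=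
  (-1 : ℝ) ^ (n + k) / (n.factorial : ℝ) *
    ∑ j ∈ Finset.Icc ((k + 1) / 2) (min k n),
      (j : ℝ) ^ (n + 1) * (n.choose j : ℝ) * ((2 * j).choose j : ℝ) * (j.choose (k - j) : ℝ)

/-- The `n`-th Gaver–Stehfest approximation
`f_n(x) = (ln 2 / x) ∑_{k=1}^{2n} a_k(n) F(k ln 2 / x)`. -/
noncomputable def gaverStehfest (f : ℝ → ℝ) (n : ℕ) (x : ℝ) : ℝ :=
  Real.log 2 * x⁻¹ *
    ∑ k ∈ Finset.Icc 1 (2 * n),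
      gaverStehfestCoeff n k * laplaceTransform f ((k : ℝ) * Real.log 2 * x⁻¹)

/-! Put c = ln 2 / x and P_n(y) = ∑ a_k(n) y^k. The approximation is the integral of c P_n(e^{-ct})
f(t), and it reproduces constants because ∑ a_k(n)/k = 1. Hence the error is ∫ c P_n(e^{-ct}) (f(t)
- f(x)) dt, and t = x corresponds to y = 1/2. The integral tends to 0 by dominated convergence,
given two bounds on P_n: a uniform one, |P_n(y)| ≤ C/|1-2y|, and a geometrically small one, C n
ρ^{n-1} y, on each set |1-2y| ≥ d. Near x the first bound and the Hölder condition give the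
integrable majorant |t-x|^{α-1}; away from x the factor y = e^{-ct} in the second bound gives
integrability.

Both bounds start from P_n(y) = `diffMean` of j binom(2j,j) 4^{-j} w^j, where w = 4y(1-y) =
1-(1-2y)².

Geometric bound: `diffMean` of j w^j is, up to n!, the n-th derivative at 0 of n w e^z (w e^z -
1)^{n-1}. Cauchy's estimate on |z| = r with w = e^{-r²/2} gains a factor ρ < 1 per power, because
|e^{-|z|²/2} e^z - 1| < |z| for z ≠ 0 (`norm_cexp_sub_one_lt`). The central binomial factor is then
put back by averaging over w e^{-t}.

Uniform bound: `diffMean` of j^{-1} e^{-q/j} is nonnegative, since y^{n-1} e^{-q/y} has a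
nonnegative n-th derivative. Gaussian Fourier integrals express e^{-jt} and √j e^{-jv²} through this
kernel, so their means are at most 1 and 1/(v√π). Finally j binom(2j,j) 4^{-j} is √(j/π) plus the
Laplace transform of an integrable function (`mul_centralBinom_eq`), so these two means control it.
-/

/-! ### The normalized finite-difference functional -/

/-- The linear functional `ψ ↦ (1/n!) Δⁿ (j ↦ jⁿ ψ(j)) (0)`; its total weight is `1`. -/
noncomputable def diffMean (n : ℕ) (ψ : ℕ → ℝ) : ℝ :=
  (n.factorial : ℝ)⁻¹ *
    ∑ j ∈ Finset.range (n + 1), (-1 : ℝ) ^ (n + j) * (n.choose j : ℝ) * (j : ℝ) ^ n * ψ j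

/-- The factor j^n kills the term j = 0 when n ≠ 0, so weights such as 1/j and integrals that
diverge at j = 0 are harmless. -/
lemma diffMean_congr {n : ℕ} (hn : n ≠ 0) {ψ χ : ℕ → ℝ} (h : ∀ j, 1 ≤ j → ψ j = χ j) :
    diffMean n ψ = diffMean n χ := by
  unfold diffMean
  congr 1
  refine Finset.sum_congr rfl fun j _ => ?_
  rcases Nat.eq_zero_or_pos j with rfl | hj
  · simp [hn]
  · rw [h j hj]

lemma diffMean_add (n : ℕ) (ψ χ : ℕ → ℝ) :
    diffMean n (fun j => ψ j + χ j) = diffMean n ψ + diffMean n χ := by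
  simp only [diffMean, mul_add, Finset.sum_add_distrib]

lemma diffMean_const_mul (n : ℕ) (c : ℝ) (ψ : ℕ → ℝ) :
    diffMean n (fun j => c * ψ j) = c * diffMean n ψ := by
  simp only [diffMean, Finset.mul_sum]
  exact Finset.sum_congr rfl fun j _ => by ring

lemma diffMean_integral {X : Type*} [MeasurableSpace X] {μ : Measure X} {n : ℕ} (hn : n ≠ 0)
    {ψ : ℕ → X → ℝ} (h : ∀ j, 1 ≤ j → Integrable (ψ j) μ) :
    diffMean n (fun j => ∫ t, ψ j t ∂μ) = ∫ t, diffMean n (fun j => ψ j t) ∂μ := by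
  unfold diffMean
  rw [integral_const_mul, integral_finsetSum]
  · simp only [integral_const_mul]
  · intro j _
    rcases Nat.eq_zero_or_pos j with rfl | hj
    · simp [hn]
    · exact (h j hj).const_mul _

lemma diffMean_integrable {X : Type*} [MeasurableSpace X] {μ : Measure X} {n : ℕ} (hn : n ≠ 0)
    {ψ : ℕ → X → ℝ} (h : ∀ j, 1 ≤ j → Integrable (ψ j) μ) :
    Integrable (fun t => diffMean n (fun j => ψ j t)) μ := by
  unfold diffMean
  refine Integrable.const_mul (integrable_finsetSum _ fun j _ => ?_) _
  rcases Nat.eq_zero_or_pos j with rfl | hj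
  · simp [hn]
  · exact (h j hj).const_mul _

lemma factorial_mul_diffMean (n : ℕ) (ψ : ℕ → ℝ) :
    n.factorial * diffMean n ψ = (fwdDiff 1)^[n] (fun j : ℕ => (j : ℝ) ^ n * ψ j) 0 := by
  rw [diffMean, mul_inv_cancel_left₀ (by positivity), fwdDiff_iter_eq_sum_shift]
  refine Finset.sum_congr rfl fun j hj => ?_
  have hj' : j ≤ n := Nat.lt_succ_iff.mp (Finset.mem_range.mp hj)
  have : (-1 : ℝ) ^ (n + j) = (-1) ^ (n - j) := by
    obtain ⟨k, rfl⟩ := Nat.exists_eq_add_of_le hj'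
    rw [Nat.add_sub_cancel_left, show j + k + j = k + 2 * j by ring, pow_add, pow_mul]
    simp
  rw [this, zsmul_eq_mul]
  push_cast
  simp
  ring

lemma diffMean_one (n : ℕ) : diffMean n (fun _ => 1) = 1 := by
  have h := factorial_mul_diffMean n (fun _ => 1)
  have h2 : (fwdDiff 1)^[n] (fun j : ℕ => (j : ℝ) ^ n * 1) 0
      = (fwdDiff 1)^[n] (fun r : ℝ => r ^ n) 0 := by
    rw [fwdDiff_iter_eq_sum_shift, fwdDiff_iter_eq_sum_shift]
    simp
  rw [h2, fwdDiff_iter_eq_factorial] at h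
  have h3 : (n.factorial : ℝ) ≠ 0 := by positivity
  simpa [h3] using h

/-! ### The coefficients: generating polynomial and normalization -/

/-- Interchange the sums over k and j and set k = j + i: the limits on j in the coefficient say
exactly that j ≤ k ≤ 2j and j ≤ n. One factor of j^{n+1} moves into the argument of `diffMean`. -/
lemma sum_gaverStehfestCoeff_mul (n : ℕ) (c : ℕ → ℝ) :
    ∑ k ∈ Finset.Icc 1 (2 * n), gaverStehfestCoeff n k * c k =
      diffMean n (fun j => j * ((2 * j).choose j : ℝ) *
        ∑ i ∈ Finset.range (j + 1), (-1 : ℝ) ^ i * (j.choose i : ℝ) * c (j + i)) := by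
  have hz : diffMean n (fun j => j * ((2 * j).choose j : ℝ) *
        ∑ i ∈ Finset.range (j + 1), (-1 : ℝ) ^ i * (j.choose i : ℝ) * c (j + i)) =
      (n.factorial : ℝ)⁻¹ * ∑ j ∈ Finset.Icc 1 n, (-1 : ℝ) ^ (n + j) * (n.choose j : ℝ) *
        (j : ℝ) ^ n * (j * ((2 * j).choose j : ℝ) *
        ∑ i ∈ Finset.range (j + 1), (-1 : ℝ) ^ i * (j.choose i : ℝ) * c (j + i)) := by
    unfold diffMean
    congr 1
    symm
    refine Finset.sum_subset (fun j hj => ?_) (fun j hj hj' => ?_)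
    · simp only [Finset.mem_Icc, Finset.mem_range] at *; omega
    · have : j = 0 := by simp only [Finset.mem_Icc, Finset.mem_range] at *; omega
      simp [this]
  rw [hz]
  simp only [gaverStehfestCoeff, Finset.mul_sum, Finset.sum_mul]
  rw [Finset.sum_comm' (t' := Finset.Icc 1 n) (s' := fun j => Finset.Icc j (2 * j))]
  · refine Finset.sum_congr rfl fun j _ => ?_
    have : Finset.Icc j (2 * j) = (Finset.range (j + 1)).map (addLeftEmbedding j) := by
      ext k
      simp only [Finset.mem_Icc, Finset.mem_map, Finset.mem_range, addLeftEmbedding_apply]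
      constructor
      · intro h
        exact ⟨k - j, by omega, by omega⟩
      · rintro ⟨a, h, rfl⟩
        omega
    rw [this, Finset.sum_map]
    refine Finset.sum_congr rfl fun i _ => ?_
    simp only [addLeftEmbedding_apply, Nat.add_sub_cancel_left]
    ring
  · intro k j
    simp only [Finset.mem_Icc]
    omega

lemma fwdDiff_iter_inv (m x : ℕ) :
    (fwdDiff 1)^[m] (fun k : ℕ => ((k : ℝ) + 1)⁻¹) x =
      (-1) ^ m * m.factorial / ((x + 1).ascFactorial (m + 1) : ℝ) := by
  induction m generalizing x with
  | zero => simp [Nat.ascFactorial]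
  | succ m ih =>
    rw [Function.iterate_succ_apply', fwdDiff, ih, ih]
    have h2 : ((x + 1).ascFactorial (m + 2) : ℝ) =
        (x + 1 + (m + 1)) * (x + 1).ascFactorial (m + 1) := by
      rw [Nat.ascFactorial_succ]
      push_cast
      ring
    have h1 : ((x + 1).ascFactorial (m + 2) : ℝ) = (x + 1) * (x + 2).ascFactorial (m + 1) := by
      rw [h2]
      exact_mod_cast (Nat.succ_ascFactorial (x + 1) (m + 1)).symm
    have p1 : (0 : ℝ) < (x + 1).ascFactorial (m + 1) := by
      exact_mod_cast Nat.ascFactorial_pos x (m + 1)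
    have p2 : (0 : ℝ) < (x + 2).ascFactorial (m + 1) := by
      exact_mod_cast Nat.ascFactorial_pos (x + 1) (m + 1)
    have h3 : (x + 1 + (m + 1) : ℝ) * (x + 1).ascFactorial (m + 1) =
        (x + 1) * (x + 2).ascFactorial (m + 1) := h2.symm.trans h1
    rw [h1, Nat.factorial_succ]
    have h4 : ((x + 1).ascFactorial (m + 1) : ℝ) =
        (x + 1) * (x + 2).ascFactorial (m + 1) / (x + 1 + (m + 1)) := by
      rw [← h3]; field_simp
    rw [show x + 1 + 1 = x + 2 from rfl, h4]
    push_cast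
    field_simp
    ring

/-- The sum is the Beta value B(j, j+1), obtained here as the j-th difference of k ↦ 1/(k+1) at k =
j-1. -/
lemma sum_choose_div (j : ℕ) (hj : 1 ≤ j) :
    (j : ℝ) * ((2 * j).choose j : ℝ) *
      ∑ i ∈ Finset.range (j + 1), (-1 : ℝ) ^ i * (j.choose i : ℝ) * ((j + i : ℕ) : ℝ)⁻¹ = 1 := by
  obtain ⟨k, rfl⟩ := Nat.exists_eq_add_of_le' hj
  have h := fwdDiff_iter_inv (k + 1) k
  rw [fwdDiff_iter_eq_sum_shift] at h
  have h1 : ∑ i ∈ Finset.range (k + 1 + 1),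
      (-1 : ℝ) ^ i * ((k + 1).choose i : ℝ) * ((k + 1 + i : ℕ) : ℝ)⁻¹ =
      (k + 1).factorial / ((k + 1).ascFactorial (k + 1 + 1) : ℝ) := by
    have h2 := congrArg (fun t : ℝ => (-1) ^ (k + 1) * t) h
    simp only [Finset.mul_sum, mul_div_assoc, ← mul_assoc, ← mul_pow] at h2
    rw [← mul_div_assoc] at h2
    norm_num at h2
    rw [← h2]
    refine Finset.sum_congr rfl fun i hi => ?_
    have hi' : i ≤ k + 1 := Nat.lt_succ_iff.mp (Finset.mem_range.mp hi)
    have hs : (-1 : ℝ) ^ (k + 1) * (-1) ^ (k + 1 - i) = (-1) ^ i := by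
      rw [← pow_add, show k + 1 + (k + 1 - i) = i + 2 * (k + 1 - i) by omega, pow_add, pow_mul]
      simp
    rw [← hs]
    push_cast
    ring
  rw [h1]
  have h2 := Nat.factorial_mul_ascFactorial k (k + 1 + 1)
  have h3 := Nat.choose_mul_factorial_mul_factorial (show k + 1 ≤ 2 * (k + 1) by omega)
  rw [show 2 * (k + 1) - (k + 1) = k + 1 by omega] at h3
  rw [show k + (k + 1 + 1) = 2 * (k + 1) by ring, ← h3, Nat.factorial_succ k] at h2
  have p : (0 : ℝ) < (k + 1).ascFactorial (k + 1 + 1) := by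
    exact_mod_cast Nat.ascFactorial_pos k _
  have h4 : ((k.factorial : ℕ) : ℝ) * (k + 1).ascFactorial (k + 1 + 1) =
      (2 * (k + 1)).choose (k + 1) * ((k + 1) * k.factorial) * ((k + 1) * k.factorial) := by
    exact_mod_cast h2
  have p2 : (0 : ℝ) < k.factorial := by positivity
  rw [Nat.factorial_succ]
  push_cast
  field_simp
  have := mul_left_cancel₀ p2.ne' (a := (k.factorial : ℝ))
    (b := (k + 1).ascFactorial (k + 1 + 1))
    (c := (2 * (k + 1)).choose (k + 1) * ((k + 1)) * ((k + 1) * k.factorial))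
    (by linarith)
  rw [this]
  ring

lemma sum_gaverStehfestCoeff_div {n : ℕ} (hn : n ≠ 0) :
    ∑ k ∈ Finset.Icc 1 (2 * n), gaverStehfestCoeff n k * (k : ℝ)⁻¹ = 1 := by
  rw [sum_gaverStehfestCoeff_mul n (fun k => (k : ℝ)⁻¹)]
  exact (diffMean_congr hn fun j hj => sum_choose_div j hj).trans (diffMean_one n)

lemma sum_gaverStehfestCoeff_pow (n : ℕ) (y : ℝ) :
    ∑ k ∈ Finset.Icc 1 (2 * n), gaverStehfestCoeff n k * y ^ k =
      diffMean n (fun j => j * ((2 * j).choose j / 4 ^ j : ℝ) * (4 * (y * (1 - y))) ^ j) := by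
  rw [sum_gaverStehfestCoeff_mul n (fun k => y ^ k)]
  congr 1
  ext j
  have : ∑ i ∈ Finset.range (j + 1), (-1 : ℝ) ^ i * (j.choose i : ℝ) * y ^ (j + i) =
      (y * (1 - y)) ^ j := by
    rw [mul_pow, show (1 - y) = -y + 1 by ring, add_pow, Finset.mul_sum]
    refine Finset.sum_congr rfl fun i _ => ?_
    rw [neg_pow y i, pow_add]
    ring
  rw [this, mul_pow 4]
  field_simp

/-! ### The inequality |e^{-|z|²/2} e^z - 1| < |z| -/

lemma hasDerivAt_one_add_mul_exp (x : ℝ) :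
    HasDerivAt (fun x : ℝ => (1 + x) * Real.exp (-x + x ^ 2 / 2))
      (x ^ 2 * Real.exp (-x + x ^ 2 / 2)) x := by
  have h1 : HasDerivAt (fun x : ℝ => -x + x ^ 2 / 2) (-1 + x) x := by
    refine ((hasDerivAt_id x).neg.add (((hasDerivAt_id x).pow 2).div_const 2)).congr_deriv ?_
    simp
  refine (((hasDerivAt_id x).const_add 1).mul h1.exp).congr_deriv ?_
  simp only [id]
  ring

lemma exp_sub_sq_div_two_lt {x : ℝ} (hx : 0 < x) : Real.exp (x - x ^ 2 / 2) < 1 + x := by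
  have hm : StrictMonoOn (fun x : ℝ => (1 + x) * Real.exp (-x + x ^ 2 / 2)) (Ici 0) := by
    refine strictMonoOn_of_deriv_pos (convex_Ici 0) (by fun_prop) fun y hy => ?_
    rw [interior_Ici] at hy
    rw [(hasDerivAt_one_add_mul_exp y).deriv]
    have : (0 : ℝ) < y := hy
    positivity
  have h := hm self_mem_Ici hx.le hx
  simp only [add_zero, neg_zero, one_mul] at h
  norm_num at h
  have e : Real.exp (x - x ^ 2 / 2) * Real.exp (-x + x ^ 2 / 2) = 1 := by
    rw [← Real.exp_add]; ring_nf; simp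
  have p := Real.exp_pos (-x + x ^ 2 / 2)
  by_contra! hc
  nlinarith [mul_le_mul_of_nonneg_right hc p.le]

lemma one_sub_lt_exp_neg_sub_sq {b : ℝ} (hb : 0 < b) : 1 - b < Real.exp (-b - b ^ 2 / 2) := by
  have hm : StrictMonoOn (fun x : ℝ => (1 + x) * Real.exp (-x + x ^ 2 / 2)) (Iic 0) := by
    refine strictMonoOn_of_deriv_pos (convex_Iic 0) (by fun_prop) fun y hy => ?_
    rw [interior_Iic] at hy
    rw [(hasDerivAt_one_add_mul_exp y).deriv]
    have h0 : y ≠ 0 := ne_of_lt hy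
    positivity
  have hb' : -b < 0 := by linarith
  have h := hm (mem_Iic.mpr hb'.le) self_mem_Iic hb'
  norm_num at h
  have e : Real.exp (-b - b ^ 2 / 2) * Real.exp (b + b ^ 2 / 2) = 1 := by
    rw [← Real.exp_add]; ring_nf; simp
  have p := Real.exp_pos (b + b ^ 2 / 2)
  by_contra! hc
  nlinarith [mul_le_mul_of_nonneg_right hc p.le]

/-- The real form of the inequality: x = Re z, Y = (Im z)²/2 and E is the modulus of e^{-|z|²/2}
e^z. It is what remains after cos(Im z) is replaced by its lower bound 1 - Y. -/
lemma sq_sub_mul_lt_of_exp {x Y E : ℝ} (hY : 0 ≤ Y) (h0 : x ≠ 0 ∨ 0 < Y)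
    (hE : E = Real.exp (x - x ^ 2 / 2 - Y)) : (1 - E) ^ 2 - (1 - E) * (2 * Y) < x ^ 2 := by
  have Epos : 0 < E := hE ▸ Real.exp_pos _
  rcases le_or_gt E 1 with h1 | h1
  -- With d = 1 - E the left side is (d-Y)² - Y². Thus d ≤ Y makes it nonpositive, and Y < d < Y +
  -- |x| makes it less than x². For x ≤ 0 compare E with exp(-b - b²/2), b = Y + |x|; for 0 < x ≤ 2
  -- use x - x²/2 ≥ 0.
  · have key : 1 - E < Y + |x| ∨ 1 - E ≤ Y := by
      rcases le_or_gt x 0 with hx | hx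
      · left
        have hb : 0 < Y + |x| := by
          rcases h0 with h | h
          · positivity
          · positivity
        have h2 := one_sub_lt_exp_neg_sub_sq hb
        have h3 : Real.exp (-(Y + |x|) - (Y + |x|) ^ 2 / 2) ≤ E := by
          rw [hE, Real.exp_le_exp, abs_of_nonpos hx]
          nlinarith
        linarith
      · rcases le_or_gt x 2 with hx2 | hx2
        · right
          have h3 : Real.exp (-Y) ≤ E := by
            rw [hE, Real.exp_le_exp]
            nlinarith
          linarith [Real.one_sub_le_exp_neg Y]
        · left
          rw [abs_of_pos hx]
          linarith
    have hx2 : x ^ 2 = |x| ^ 2 := (sq_abs x).symm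
    rcases le_or_gt (1 - E) Y with hd | hd
    · rcases h0 with h | h
      · have : 0 < x ^ 2 := by positivity
        nlinarith [mul_nonneg (sub_nonneg.mpr h1) hY]
      · by_cases hx : x = 0
        · have : E < 1 := by
            rw [hE, hx, Real.exp_lt_one_iff]
            linarith
          nlinarith [mul_pos (sub_pos.mpr this) h]
        · have : 0 < x ^ 2 := by positivity
          nlinarith [mul_nonneg (sub_nonneg.mpr h1) hY]
    · have hk : 1 - E < Y + |x| := key.resolve_right (not_le.mpr hd)
      rw [hx2]
      nlinarith
  · have hx : 0 < x := by
      by_contra! hx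
      have : E ≤ 1 := by
        rw [hE, Real.exp_le_one_iff]
        nlinarith [sq_nonneg x]
      linarith
    have h2 : E = Real.exp (x - x ^ 2 / 2) * Real.exp (-Y) := by
      rw [hE, ← Real.exp_add]; ring_nf
    have h3 : E * (1 + Y) < 1 + x := by
      have h4 : Real.exp (-Y) * (1 + Y) ≤ 1 := by
        have e : Real.exp (-Y) * Real.exp Y = 1 := by rw [← Real.exp_add]; simp
        nlinarith [Real.add_one_le_exp Y, Real.exp_pos (-Y)]
      have := exp_sub_sq_div_two_lt hx
      nlinarith [Real.exp_pos (x - x ^ 2 / 2)]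
    set η := E - 1 with hη
    have hηpos : 0 < η := by linarith
    have h4 : η * (1 + Y) < x - Y := by nlinarith
    have hYx : Y < x := by nlinarith
    -- The left side is (η² + 2Yη)(1+Y)², the quantity to be bounded times (1+Y)².
    have h5 : (η * (1 + Y)) * (η * (1 + Y) + 2 * Y * (1 + Y)) <
        (x - Y) * (x - Y + 2 * Y * (1 + Y)) := by
      apply mul_lt_mul'' h4 <;> nlinarith
    have h6 : (x - Y) * (x - Y + 2 * Y * (1 + Y)) ≤ x ^ 2 * (1 + Y) ^ 2 := by
      nlinarith [mul_nonneg hY hx.le, mul_nonneg (mul_nonneg hY hY) hx.le,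
        mul_nonneg (mul_nonneg hY hY) hY, mul_nonneg (mul_nonneg hY hx.le) (sub_nonneg.mpr hYx.le),
        sq_nonneg (x * Y)]
    have h7 : (η ^ 2 + η * (2 * Y)) * (1 + Y) ^ 2 < x ^ 2 * (1 + Y) ^ 2 := by
      nlinarith
    have h8 := lt_of_mul_lt_mul_right h7 (by positivity)
    have : (1 - E) = -η := by rw [hη]; ring
    rw [this]
    linarith

lemma norm_cexp_sub_one_lt {z : ℂ} (hz : z ≠ 0) :
    ‖(Real.exp (-(‖z‖ ^ 2 / 2)) : ℂ) * Complex.exp z - 1‖ < ‖z‖ := by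
  set E := Real.exp (z.re - z.re ^ 2 / 2 - z.im ^ 2 / 2) with hE
  have hn : ‖z‖ ^ 2 = z.re ^ 2 + z.im ^ 2 := by
    rw [← Complex.normSq_eq_norm_sq, Complex.normSq_apply]; ring
  have h1 : (Real.exp (-(‖z‖ ^ 2 / 2)) : ℂ) * Complex.exp z =
      ⟨E * Real.cos z.im, E * Real.sin z.im⟩ := by
    have : E = Real.exp (-(‖z‖ ^ 2 / 2)) * Real.exp z.re := by
      rw [hE, hn, ← Real.exp_add]; ring_nf
    apply Complex.ext
    · rw [Complex.re_ofReal_mul, Complex.exp_re, this]; ring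
    · rw [Complex.im_ofReal_mul, Complex.exp_im, this]; ring
  refine lt_of_pow_lt_pow_left₀ 2 (norm_nonneg z) ?_
  rw [h1, hn, ← Complex.normSq_eq_norm_sq, Complex.normSq_apply]
  simp only [Complex.sub_re, Complex.sub_im, Complex.one_re, Complex.one_im]
  have h0 : z.re ≠ 0 ∨ 0 < z.im ^ 2 / 2 := by
    by_contra! h
    have : z.im = 0 := by nlinarith [sq_nonneg z.im, h.2]
    exact hz (Complex.ext h.1 this)
  have h2 := sq_sub_mul_lt_of_exp (by positivity) h0 hE
  have h3 := Real.one_sub_sq_div_two_le_cos (x := z.im)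
  have Epos : 0 < E := Real.exp_pos _
  nlinarith [Real.sin_sq_add_cos_sq z.im, mul_le_mul_of_nonneg_left h3 Epos.le]

/-- Compactness of the annulus turns the strict inequality into a uniform ratio. -/
lemma exists_norm_cexp_sub_one_le {a : ℝ} (ha : 0 < a) (b : ℝ) :
    ∃ ρ : ℝ, 0 ≤ ρ ∧ ρ < 1 ∧ ∀ z : ℂ, a ≤ ‖z‖ → ‖z‖ ≤ b →
      ‖(Real.exp (-(‖z‖ ^ 2 / 2)) : ℂ) * Complex.exp z - 1‖ ≤ ρ * ‖z‖ := by
  set K : Set ℂ := {z | a ≤ ‖z‖ ∧ ‖z‖ ≤ b}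
  have hK : IsCompact K := by
    refine Metric.isCompact_of_isClosed_isBounded ?_ ?_
    · exact (isClosed_le continuous_const continuous_norm).inter
        (isClosed_le continuous_norm continuous_const)
    · exact Metric.isBounded_closedBall.subset (s := K) (t := Metric.closedBall 0 b)
        fun z hz => by simpa using hz.2
  rcases K.eq_empty_or_nonempty with he | hne
  · refine ⟨0, le_rfl, one_pos, fun z h1 h2 => ?_⟩
    have : z ∈ K := ⟨h1, h2⟩
    simp [he] at this
  · have hpos : ∀ z ∈ K, 0 < ‖z‖ := fun z hz => ha.trans_le hz.1
    obtain ⟨z₀, hz₀, hmax⟩ := hK.exists_isMaxOn hne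
      (f := fun z => ‖(Real.exp (-(‖z‖ ^ 2 / 2)) : ℂ) * Complex.exp z - 1‖ / ‖z‖)
      (ContinuousOn.div (by fun_prop) (by fun_prop) fun z hz => (hpos z hz).ne')
    refine ⟨‖(Real.exp (-(‖z₀‖ ^ 2 / 2)) : ℂ) * Complex.exp z₀ - 1‖ / ‖z₀‖, by positivity, ?_, ?_⟩
    · rw [div_lt_one (hpos z₀ hz₀)]
      exact norm_cexp_sub_one_lt (norm_pos_iff.mp (hpos z₀ hz₀))
    · intro z h1 h2
      rw [← div_le_iff₀ (hpos z ⟨h1, h2⟩)]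
      exact hmax ⟨h1, h2⟩

/-! ### Geometric decay by Cauchy's estimate -/

/-- This is u d/du applied to (u-1)^{m+1}. -/
lemma sum_alternating_choose_mul (m : ℕ) (u : ℂ) :
    ∑ j ∈ Finset.range (m + 1 + 1), (-1 : ℂ) ^ (m + 1 + j) * ((m + 1).choose j : ℂ) *
      ((j : ℂ) * u ^ j) = (m + 1) * u * (u - 1) ^ m := by
  rw [Finset.sum_range_succ', show u - 1 = u + -1 by ring, add_pow, Finset.mul_sum]
  simp only [Nat.cast_zero, zero_mul, mul_zero, add_zero]
  refine Finset.sum_congr rfl fun j hj => ?_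
  have hj' : j ≤ m := Nat.lt_succ_iff.mp (Finset.mem_range.mp hj)
  have h1 : ((m + 1).choose (j + 1) : ℂ) * (j + 1) = (m + 1) * m.choose j := by
    exact_mod_cast (Nat.add_one_mul_choose_eq m j).symm
  have h2 : (-1 : ℂ) ^ (m + 1 + (j + 1)) = (-1) ^ (m - j) := by
    obtain ⟨k, rfl⟩ := Nat.exists_eq_add_of_le hj'
    rw [Nat.add_sub_cancel_left, show j + k + 1 + (j + 1) = k + 2 * (j + 1) by ring, pow_add,
      pow_mul]
    simp
  rw [h2]
  push_cast
  linear_combination (-1 : ℂ) ^ (m - j) * u ^ (j + 1) * h1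

/-- Substituting u = w e^z and differentiating m+1 times at z = 0 produces the weights j^{m+1};
Cauchy's estimate on |z| = r cancels the factorial. -/
lemma abs_diffMean_mul_pow_le (m : ℕ) {w r M : ℝ} (hw : 0 ≤ w) (hr : 0 < r)
    (hM : ∀ z : ℂ, ‖z‖ = r → ‖(w : ℂ) * Complex.exp z - 1‖ ≤ M) :
    |diffMean (m + 1) (fun j => j * w ^ j)| ≤
      (m + 1) * (w * Real.exp r) * M ^ m / r ^ (m + 1) := by
  set f : ℂ → ℂ := fun z => (m + 1) * (w * Complex.exp z) * (w * Complex.exp z - 1) ^ m with hf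
  have hf2 : f = fun z => ∑ j ∈ Finset.range (m + 1 + 1), (-1 : ℂ) ^ (m + 1 + j) *
      ((m + 1).choose j : ℂ) * ((j : ℂ) * (w : ℂ) ^ j) * Complex.exp (j * z) := by
    ext z
    rw [hf]
    simp only
    rw [← sum_alternating_choose_mul]
    refine Finset.sum_congr rfl fun j _ => ?_
    rw [mul_pow, ← Complex.exp_nat_mul]
    ring
  have hd : iteratedDeriv (m + 1) f 0 =
      (((m + 1).factorial * diffMean (m + 1) (fun j => j * w ^ j) : ℝ) : ℂ) := by
    rw [hf2, iteratedDeriv_fun_sum (fun j _ => by fun_prop), diffMean,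
      mul_inv_cancel_left₀ (by positivity)]
    push_cast
    refine Finset.sum_congr rfl fun j _ => ?_
    rw [iteratedDeriv_const_mul_field, iteratedDeriv_cexp_const_mul]
    simp
    ring
  have hb := Complex.norm_iteratedDeriv_le_of_forall_mem_sphere_norm_le (c := 0) (R := r) (f := f)
    (C := (m + 1) * (w * Real.exp r) * M ^ m) (m + 1) hr
    (Differentiable.diffContOnCl (by fun_prop)) (by
      intro z hz
      have hz' : ‖z‖ = r := by simpa using hz
      rw [hf]
      simp only [norm_mul, norm_pow]
      have h1 : ‖(m + 1 : ℂ)‖ = m + 1 := by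
        rw [show (m + 1 : ℂ) = ((m + 1 : ℕ) : ℂ) by push_cast; rfl, Complex.norm_natCast]
        push_cast; rfl
      have h2 : ‖Complex.exp z‖ ≤ Real.exp r := by
        rw [Complex.norm_exp, Real.exp_le_exp, ← hz']
        exact Complex.re_le_norm z
      rw [h1, Complex.norm_real, Real.norm_of_nonneg hw]
      gcongr
      exact hM z hz')
  rw [hd, Complex.norm_real, Real.norm_eq_abs, abs_mul, Nat.abs_cast, mul_div_assoc] at hb
  exact le_of_mul_le_mul_left hb (by positivity)

lemma exists_abs_diffMean_mul_pow_le {w₀ : ℝ} (h0 : 0 < w₀) (h1 : w₀ < 1) :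
    ∃ ρ C : ℝ, 0 ≤ ρ ∧ ρ < 1 ∧ 0 ≤ C ∧ ∀ (m : ℕ) (w : ℝ), 0 ≤ w → w ≤ w₀ →
      |diffMean (m + 1) (fun j => j * w ^ j)| ≤ C * ((m + 1) * ρ ^ m) * w := by
  set a := Real.sqrt (-2 * Real.log w₀) with ha
  have ha0 : 0 < a := Real.sqrt_pos.mpr (by nlinarith [Real.log_neg h0 h1])
  obtain ⟨ρ, hρ0, hρ1, hρ⟩ := exists_norm_cexp_sub_one_le ha0 4
  refine ⟨max ρ (1 / 2), Real.exp 4 / a + Real.exp 4, le_max_of_le_left hρ0,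
    max_lt hρ1 (by norm_num), by positivity, fun m w hw hw' => ?_⟩
  -- The optimal radius r = √(-2 log w) is unbounded as w → 0. Below e^{-8} the fixed radius 4
  -- suffices, with M = 2 and ratio 2/4; above it, r lies in [a, 4], where ρ is uniform.
  rcases le_or_gt w (Real.exp (-8)) with hs | hs
  · have h := abs_diffMean_mul_pow_le m (r := 4) (M := 2) hw (by norm_num) (fun z hz => by
      calc ‖(w : ℂ) * Complex.exp z - 1‖ ≤ ‖(w : ℂ) * Complex.exp z‖ + ‖(1 : ℂ)‖ := norm_sub_le _ _
        _ ≤ Real.exp (-8) * Real.exp 4 + 1 := by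
          rw [norm_mul, Complex.norm_real, Real.norm_of_nonneg hw, Complex.norm_exp, norm_one]
          gcongr
          exact (Complex.re_le_norm z).trans hz.le
        _ ≤ 2 := by
          rw [← Real.exp_add]
          have : Real.exp (-8 + 4) ≤ 1 := by rw [Real.exp_le_one_iff]; norm_num
          linarith)
    refine h.trans ?_
    have e : (m + 1) * (w * Real.exp 4) * 2 ^ m / 4 ^ (m + 1) =
        Real.exp 4 / 4 * ((m + 1) * (1 / 2) ^ m) * w := by
      rw [pow_succ, show (4 : ℝ) ^ m = 2 ^ m * 2 ^ m by rw [← mul_pow]; norm_num, one_div, inv_pow]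
      field_simp
    rw [e]
    gcongr
    · have : 0 ≤ Real.exp 4 / a := by positivity
      linarith [Real.exp_pos 4]
    · exact le_max_right _ _
  · have hwpos : 0 < w := (Real.exp_pos _).trans hs
    set r := Real.sqrt (-2 * Real.log w) with hr
    have hlog : Real.log w ≤ Real.log w₀ := Real.log_le_log hwpos hw'
    have har : a ≤ r := Real.sqrt_le_sqrt (by linarith)
    have hlog8 : -8 ≤ Real.log w := by
      rw [Real.le_log_iff_exp_le hwpos]; exact hs.le
    have hr4 : r ≤ 4 := by
      rw [hr, Real.sqrt_le_left (by norm_num)]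
      nlinarith
    have hr0 : 0 < r := ha0.trans_le har
    have hr2 : r ^ 2 = -2 * Real.log w := Real.sq_sqrt (by nlinarith [Real.log_neg h0 h1])
    have hwr : w = Real.exp (-(r ^ 2 / 2)) := by
      rw [hr2, show -(-2 * Real.log w / 2) = Real.log w by ring, Real.exp_log hwpos]
    have h := abs_diffMean_mul_pow_le m (r := r) (M := ρ * r) hw hr0 (fun z hz => by
      have := hρ z (by rw [hz]; exact har) (by rw [hz]; exact hr4)
      rw [hz, ← hwr] at this
      exact this)
    refine h.trans ?_
    have e : (m + 1) * (w * Real.exp r) * (ρ * r) ^ m / r ^ (m + 1) =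
        Real.exp r / r * ((m + 1) * ρ ^ m) * w := by
      rw [pow_succ, mul_pow]
      field_simp
    rw [e]
    gcongr
    · have : Real.exp r / r ≤ Real.exp 4 / a := by gcongr
      linarith [Real.exp_pos 4]
    · exact le_max_left _ _

/-! ### Positivity of the kernel `diffMean` of j^{-1} e^{-q/j} -/

/-- One difference of the whole chain of derivatives is again such a chain, and its n-th member is
nonnegative because the n-th member of the old chain is monotone. -/
lemma fwdDiff_iter_nonneg (n : ℕ) (F : ℕ → ℝ → ℝ)
    (hF : ∀ i, ∀ y : ℝ, 0 < y → HasDerivAt (F i) (F (i + 1) y) y)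
    (hn : ∀ y : ℝ, 0 < y → 0 ≤ F n y) {y : ℝ} (hy : 0 < y) :
    0 ≤ (fwdDiff 1)^[n] (F 0) y := by
  induction n generalizing F y with
  | zero => exact hn y hy
  | succ n ih =>
    rw [Function.iterate_succ_apply]
    refine ih (fun i y => F i (y + 1) - F i y) (fun i y hy => ?_) (fun y hy => ?_) hy
    · exact ((hF i (y + 1) (by linarith)).comp_add_const y 1).sub (hF i y hy)
    · have hm : MonotoneOn (F n) (Ioi 0) := by
        refine monotoneOn_of_deriv_nonneg (convex_Ioi 0)
          (fun z hz => (hF n z hz).continuousAt.continuousWithinAt) ?_ ?_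
        · rw [interior_Ioi]
          exact fun z hz => (hF n z hz).differentiableAt.differentiableWithinAt
        · rw [interior_Ioi]
          intro z hz
          rw [(hF n z hz).deriv]
          exact hn z hz
      exact sub_nonneg.mpr (hm hy (show (0 : ℝ) < y + 1 by linarith) (by linarith))

lemma hasDerivAt_exp_neg_div_div_pow (q : ℝ) (k : ℕ) {y : ℝ} (hy : 0 < y) :
    HasDerivAt (fun y => Real.exp (-q / y) / y ^ k)
      (q * Real.exp (-q / y) / y ^ (k + 2) - k * Real.exp (-q / y) / y ^ (k + 1)) y := by
  have h1 : HasDerivAt (fun y : ℝ => -q / y) (q / y ^ 2) y := by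
    refine ((hasDerivAt_const y (-q)).div (hasDerivAt_id y) hy.ne').congr_deriv ?_
    simp
  refine (h1.exp.div (hasDerivAt_pow k y) (by positivity)).congr_deriv ?_
  rcases k with _ | k
  · simp
    ring
  · simp only [Nat.add_sub_cancel]
    field_simp
    ring

/-- The identity `Dᵐ⁺¹ (yᵐ exp(-q/y)) = qᵐ⁺¹ exp(-q/y) / yᵐ⁺²`, stated for a sequence of
successive derivatives. -/
lemma exists_deriv_chain_pow_mul_exp (q : ℝ) (m : ℕ) :
    ∃ F : ℕ → ℝ → ℝ, (∀ i, ∀ y : ℝ, 0 < y → HasDerivAt (F i) (F (i + 1) y) y) ∧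
      (∀ y, F 0 y = y ^ m * Real.exp (-q / y)) ∧
      ∀ y, 0 < y → F (m + 1) y = q ^ (m + 1) * (Real.exp (-q / y) / y ^ (m + 2)) := by
  induction m with
  | zero =>
    -- Every derivative of e^{-q/y} is a polynomial in 1/y times e^{-q/y}; the recursion for the
    -- polynomial is p ↦ X²(qp - p').
    let P : ℕ → Polynomial ℝ := fun i => (fun p => Polynomial.X ^ 2 *
      (Polynomial.C q * p - Polynomial.derivative p))^[i] 1
    refine ⟨fun i y => (P i).eval y⁻¹ * Real.exp (-q / y), fun i y hy => ?_, fun y => ?_,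
      fun y hy => ?_⟩
    · have h1 := hasDerivAt_inv hy.ne'
      have h2 : HasDerivAt (fun y : ℝ => -q / y) (q / y ^ 2) y := by
        refine ((hasDerivAt_const y (-q)).div (hasDerivAt_id y) hy.ne').congr_deriv ?_
        simp
      have h3 : HasDerivAt (fun y => (P i).eval y⁻¹)
          ((Polynomial.derivative (P i)).eval y⁻¹ * -(y ^ 2)⁻¹) y :=
        ((P i).hasDerivAt y⁻¹).comp y h1
      refine (h3.mul h2.exp).congr_deriv ?_
      simp only [P, Function.iterate_succ_apply', Polynomial.eval_mul, Polynomial.eval_pow,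
        Polynomial.eval_X, Polynomial.eval_sub, Polynomial.eval_C]
      field_simp
      ring
    · simp [P]
    · simp [P]
      field_simp
  | succ m ih =>
    obtain ⟨F, hF, h0, hm⟩ := ih
    -- Leibniz rule for y times the previous function. At i = 0 the truncated index i - 1 is
    -- harmless, as its coefficient is 0.
    refine ⟨fun i y => y * F i y + i * F (i - 1) y, fun i y hy => ?_, fun y => ?_, fun y hy => ?_⟩
    · have h1 := (hasDerivAt_id y).mul (hF i y hy)
      rcases i with _ | i
      · refine (h1.add ((hF 0 y hy).const_mul 0)).congr_deriv ?_ |>.congr_of_eventuallyEq ?_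
        · simp; ring
        · exact Eventually.of_forall fun z => by simp
      · refine (h1.add ((hF i y hy).const_mul ((i + 1 : ℕ) : ℝ))).congr_deriv ?_
        simp
        ring
    · simp [h0, pow_succ]
      ring
    · have h2 : HasDerivAt (F (m + 1)) (q ^ (m + 1) * (q * Real.exp (-q / y) / y ^ (m + 2 + 2) -
          (m + 2 : ℕ) * Real.exp (-q / y) / y ^ (m + 2 + 1))) y := by
        refine ((hasDerivAt_exp_neg_div_div_pow q (m + 2) hy).const_mul (q ^ (m + 1))
          ).congr_of_eventuallyEq ?_
        filter_upwards [lt_mem_nhds hy] with z hz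
        exact hm z hz
      have h3 := (hF (m + 1) y hy).unique h2
      simp only [Nat.add_sub_cancel]
      rw [h3, hm y hy]
      push_cast
      field_simp
      ring

lemma diffMean_inv_mul_exp_nonneg_of_pos {n : ℕ} (hn : n ≠ 0) {q : ℝ} (hq : 0 < q) :
    0 ≤ diffMean n (fun j => (j : ℝ)⁻¹ * Real.exp (-q / j)) := by
  obtain ⟨m, rfl⟩ := Nat.exists_eq_succ_of_ne_zero hn
  obtain ⟨F, hF, h0, hm⟩ := exists_deriv_chain_pow_mul_exp q m
  have hpos : ∀ y : ℝ, 0 < y → 0 ≤ (fwdDiff 1)^[m + 1] (F 0) y := fun y hy =>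
    fwdDiff_iter_nonneg (m + 1) F hF (fun y hy => by rw [hm y hy]; positivity) hy
  rw [diffMean]
  refine mul_nonneg (by positivity) ?_
  -- The derivatives are known only for y > 0, so the difference at 0 is reached as a limit from the
  -- right. The j = 0 term vanishes in the limit because e^{-q/y} → 0, which needs q > 0.
  have hlim : Tendsto (fun y : ℝ => (fwdDiff 1)^[m + 1] (F 0) y) (𝓝[>] 0)
      (𝓝 (∑ j ∈ Finset.range (m + 1 + 1), (-1 : ℝ) ^ (m + 1 + j) * ((m + 1).choose j : ℝ) *
        (j : ℝ) ^ (m + 1) * ((j : ℝ)⁻¹ * Real.exp (-q / j)))) := by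
    simp only [fwdDiff_iter_eq_sum_shift, h0]
    refine tendsto_finsetSum _ fun j hj => ?_
    have hj' : j ≤ m + 1 := Nat.lt_succ_iff.mp (Finset.mem_range.mp hj)
    have hs : (-1 : ℝ) ^ (m + 1 + j) = (-1) ^ (m + 1 - j) := by
      obtain ⟨k, hk⟩ := Nat.exists_eq_add_of_le hj'
      rw [hk, Nat.add_sub_cancel_left, show j + k + j = k + 2 * j by ring, pow_add, pow_mul]
      simp
    rw [hs]
    rcases Nat.eq_zero_or_pos j with rfl | hj0
    · have h1 : Tendsto (fun y : ℝ => y ^ m * Real.exp (-q / y)) (𝓝[>] 0) (𝓝 (0 ^ m * 0)) := by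
        refine Tendsto.mul ?_ ?_
        · exact ((continuous_pow m).tendsto 0).mono_left nhdsWithin_le_nhds
        · have h2 : Tendsto (fun y : ℝ => -q / y) (𝓝[>] 0) atBot :=
            tendsto_inv_nhdsGT_zero.const_mul_atTop_of_neg (by linarith)
          exact Real.tendsto_exp_atBot.comp h2
      simpa using h1.const_mul ((-1 : ℝ) ^ (m + 1))
    · have hj1 : (j : ℝ) ≠ 0 := by positivity
      have h1 : ContinuousAt (fun y : ℝ => (y + j) ^ m * Real.exp (-q / (y + j))) 0 := by
        refine ContinuousAt.mul (by fun_prop) (ContinuousAt.rexp ?_)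
        exact ContinuousAt.div (by fun_prop) (by fun_prop) (by simpa using hj1)
      have h2 := (h1.tendsto.mono_left (nhdsWithin_le_nhds (s := Ioi 0))).const_mul
        ((-1 : ℝ) ^ (m + 1 - j) * ((m + 1).choose j : ℝ))
      convert h2 using 2
      · simp
      · rw [zero_add, pow_succ]
        field_simp
  exact ge_of_tendsto hlim (eventually_nhdsWithin_of_forall hpos)

lemma diffMean_inv_mul_exp_nonneg {n : ℕ} (hn : n ≠ 0) {q : ℝ} (hq : 0 ≤ q) :
    0 ≤ diffMean n (fun j => (j : ℝ)⁻¹ * Real.exp (-q / j)) := by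
  have hc : Continuous (fun q : ℝ => diffMean n (fun j => (j : ℝ)⁻¹ * Real.exp (-q / j))) := by
    unfold diffMean
    fun_prop
  have hcl : IsClosed {q : ℝ | 0 ≤ diffMean n (fun j => (j : ℝ)⁻¹ * Real.exp (-q / j))} :=
    isClosed_le continuous_const hc
  have : Ici (0 : ℝ) ⊆ {q : ℝ | 0 ≤ diffMean n (fun j => (j : ℝ)⁻¹ * Real.exp (-q / j))} := by
    rw [← closure_Ioi]
    exact hcl.closure_subset_iff.mpr fun q hq => diffMean_inv_mul_exp_nonneg_of_pos hn hq
  exact this hq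

/-! ### Gaussian Fourier integrals and uniform bounds -/

lemma cexp_add_mul_I_re (a c : ℝ) :
    (Complex.exp ((a : ℂ) + (c : ℂ) * Complex.I)).re = Real.exp a * Real.cos c := by
  simp [Complex.exp_re]

lemma integral_complex_gaussian_mul_cos {b : ℝ} (hb : 0 < b) (w : ℂ) :
    Integrable (fun v : ℂ => Real.exp (-b * ‖v‖ ^ 2) * Real.cos (2 * inner ℝ w v)) ∧
    ∫ v : ℂ, Real.exp (-b * ‖v‖ ^ 2) * Real.cos (2 * inner ℝ w v) =
      Real.pi / b * Real.exp (-‖w‖ ^ 2 / b) := by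
  have hre : ∀ v : ℂ, (Complex.exp (-(b : ℂ) * ‖v‖ ^ 2 + (2 * Complex.I) * (inner ℝ w v : ℝ))).re =
      Real.exp (-b * ‖v‖ ^ 2) * Real.cos (2 * inner ℝ w v) := by
    intro v
    have e : (-(b : ℂ) * ‖v‖ ^ 2 + (2 * Complex.I) * (inner ℝ w v : ℝ)) =
        ((-b * ‖v‖ ^ 2 : ℝ) : ℂ) + ((2 * inner ℝ w v : ℝ) : ℂ) * Complex.I := by
      push_cast; ring
    rw [e, cexp_add_mul_I_re]
  have hb' : 0 < (b : ℂ).re := by simpa using hb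
  have hi := GaussianFourier.integrable_cexp_neg_mul_sq_norm_add hb' (2 * Complex.I) w
  have hv := GaussianFourier.integral_cexp_neg_mul_sq_norm_add hb' (2 * Complex.I) w
  refine ⟨?_, ?_⟩
  · have := hi.re
    simpa only [RCLike.re_to_complex, hre] using this
  · have h2 := congrArg Complex.re hv
    rw [← RCLike.re_to_complex, ← integral_re hi] at h2
    simp only [RCLike.re_to_complex, hre] at h2
    rw [h2, Complex.finrank_real_complex]
    have e1 : ((Real.pi : ℂ) / b) ^ (((2 : ℕ) : ℂ) / 2) = ((Real.pi / b : ℝ) : ℂ) := by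
      norm_num
    have e2 : (2 * Complex.I) ^ 2 * (‖w‖ : ℂ) ^ 2 / (4 * b) = ((-‖w‖ ^ 2 / b : ℝ) : ℂ) := by
      rw [mul_pow, Complex.I_sq]
      push_cast
      field_simp
      ring
    rw [e1, e2, ← Complex.ofReal_exp, ← Complex.ofReal_mul, Complex.ofReal_re]

/-- The plane is used because the two-dimensional normalization is exactly 1/j, the weight of the
nonnegative kernel. -/
lemma exp_eq_integral_complex_gaussian {j : ℕ} (hj : 1 ≤ j) (w : ℂ) :
    Real.exp (-(j * ‖w‖ ^ 2)) = ∫ v : ℂ, Real.pi⁻¹ * Real.cos (2 * inner ℝ w v) *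
      ((j : ℝ)⁻¹ * Real.exp (-‖v‖ ^ 2 / j)) := by
  have hj0 : (0 : ℝ) < j := by exact_mod_cast hj
  have h := (integral_complex_gaussian_mul_cos (inv_pos.mpr hj0) w).2
  have e : ∀ v : ℂ, Real.pi⁻¹ * Real.cos (2 * inner ℝ w v) *
      ((j : ℝ)⁻¹ * Real.exp (-‖v‖ ^ 2 / j)) = (Real.pi⁻¹ * (j : ℝ)⁻¹) *
      (Real.exp (-(j : ℝ)⁻¹ * ‖v‖ ^ 2) * Real.cos (2 * inner ℝ w v)) := by
    intro v
    rw [show -(j : ℝ)⁻¹ * ‖v‖ ^ 2 = -‖v‖ ^ 2 / j by ring]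
    ring
  simp only [e]
  rw [integral_const_mul, h]
  have := Real.pi_pos
  rw [show -‖w‖ ^ 2 / (j : ℝ)⁻¹ = -(j * ‖w‖ ^ 2) by field_simp]
  field_simp

lemma integrable_complex_gaussian_div {j : ℕ} (hj : 1 ≤ j) (w : ℂ) :
    Integrable (fun v : ℂ => Real.pi⁻¹ * Real.cos (2 * inner ℝ w v) *
      ((j : ℝ)⁻¹ * Real.exp (-‖v‖ ^ 2 / j))) := by
  have hj0 : (0 : ℝ) < j := by exact_mod_cast hj
  have h := (integral_complex_gaussian_mul_cos (inv_pos.mpr hj0) w).1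
  convert h.const_mul (Real.pi⁻¹ * (j : ℝ)⁻¹) using 2 with v
  rw [show -(j : ℝ)⁻¹ * ‖v‖ ^ 2 = -‖v‖ ^ 2 / j by ring]
  ring

/-- By the planar Fourier formula the mean is an integral of cosines against a nonnegative weight;
frequency 0 shows that the weight has total mass `diffMean n 1 = 1`. -/
lemma abs_diffMean_exp_le {n : ℕ} (hn : n ≠ 0) {t : ℝ} (ht : 0 ≤ t) :
    |diffMean n (fun j => Real.exp (-(j * t)))| ≤ 1 := by
  set W : ℂ → ℝ := fun v => diffMean n (fun j => (j : ℝ)⁻¹ * Real.exp (-‖v‖ ^ 2 / j)) with hW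
  have hWnn : ∀ v, 0 ≤ W v := fun v => by
    simpa only [hW, neg_div] using diffMean_inv_mul_exp_nonneg hn (sq_nonneg ‖v‖)
  have hrep : ∀ w : ℂ, diffMean n (fun j => Real.exp (-(j * ‖w‖ ^ 2))) =
      ∫ v : ℂ, Real.pi⁻¹ * Real.cos (2 * inner ℝ w v) * W v := by
    intro w
    rw [diffMean_congr hn fun j hj => exp_eq_integral_complex_gaussian hj w,
      diffMean_integral hn fun j hj => integrable_complex_gaussian_div hj w]
    simp only [diffMean_const_mul, hW]
  have hint : Integrable (fun v : ℂ => Real.pi⁻¹ * W v) := by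
    have := diffMean_integrable hn fun j hj => integrable_complex_gaussian_div hj 0
    simpa [diffMean_const_mul] using this
  have hone : ∫ v : ℂ, Real.pi⁻¹ * W v = 1 := by
    have := hrep 0
    simp only [norm_zero, inner_zero_left, mul_zero, Real.cos_zero, mul_one] at this
    rw [← this, ← diffMean_one n]
    simp
  have ht' : t = ‖(Real.sqrt t : ℂ)‖ ^ 2 := by
    rw [Complex.norm_real, Real.norm_of_nonneg (Real.sqrt_nonneg t), Real.sq_sqrt ht]
  rw [ht', hrep, ← hone, ← Real.norm_eq_abs]
  refine norm_integral_le_of_norm_le hint (Eventually.of_forall fun v => ?_)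
  rw [norm_mul, norm_mul, Real.norm_of_nonneg (hWnn v), Real.norm_of_nonneg (by positivity)]
  have h1 : ‖Real.cos (2 * inner ℝ (Real.sqrt t : ℂ) v)‖ ≤ 1 := Real.abs_cos_le_one _
  have h2 : 0 ≤ Real.pi⁻¹ * W v := mul_nonneg (by positivity) (hWnn v)
  nlinarith

lemma integral_gaussian_mul_cos {b : ℝ} (hb : 0 < b) (v : ℝ) :
    Integrable (fun u : ℝ => Real.exp (-b * u ^ 2) * Real.cos (2 * u * v)) ∧
    ∫ u : ℝ, Real.exp (-b * u ^ 2) * Real.cos (2 * u * v) =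
      Real.sqrt (Real.pi / b) * Real.exp (-v ^ 2 / b) := by
  have hre : ∀ u : ℝ, (Complex.exp (-(b : ℂ) * (‖u‖ : ℂ) ^ 2 +
      (2 * Complex.I) * (inner ℝ v u : ℝ))).re =
      Real.exp (-b * u ^ 2) * Real.cos (2 * u * v) := by
    intro u
    have e : (-(b : ℂ) * (‖u‖ : ℂ) ^ 2 + (2 * Complex.I) * (inner ℝ v u : ℝ)) =
        ((-b * u ^ 2 : ℝ) : ℂ) + ((2 * u * v : ℝ) : ℂ) * Complex.I := by
      rw [← Complex.ofReal_pow, Real.norm_eq_abs, sq_abs]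
      simp
      ring
    rw [e, cexp_add_mul_I_re]
  have hb' : 0 < (b : ℂ).re := by simpa using hb
  have hi := GaussianFourier.integrable_cexp_neg_mul_sq_norm_add hb' (2 * Complex.I) v
  have hv := GaussianFourier.integral_cexp_neg_mul_sq_norm_add hb' (2 * Complex.I) v
  refine ⟨?_, ?_⟩
  · have := hi.re
    simpa only [RCLike.re_to_complex, hre] using this
  · have h2 := congrArg Complex.re hv
    rw [← RCLike.re_to_complex, ← integral_re hi] at h2
    simp only [RCLike.re_to_complex, hre] at h2
    rw [h2, Module.finrank_self]
    have e1 : ((Real.pi : ℂ) / b) ^ (((1 : ℕ) : ℂ) / 2) = ((Real.sqrt (Real.pi / b) : ℝ) : ℂ) := by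
      rw [Real.sqrt_eq_rpow, Complex.ofReal_cpow (by positivity)]
      norm_num
    have e2 : (2 * Complex.I) ^ 2 * (‖v‖ : ℂ) ^ 2 / (4 * b) = ((-v ^ 2 / b : ℝ) : ℂ) := by
      rw [mul_pow, Complex.I_sq, ← Complex.ofReal_pow ‖v‖, Real.norm_eq_abs, sq_abs]
      push_cast
      field_simp
      ring
    rw [e1, e2, ← Complex.ofReal_exp, ← Complex.ofReal_mul, Complex.ofReal_re]

lemma integrable_gaussian_mul_sin {b : ℝ} (hb : 0 < b) (v : ℝ) :
    Integrable (fun u : ℝ => u * Real.exp (-b * u ^ 2) * Real.sin (2 * u * v)) := by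
  refine (integrable_mul_exp_neg_mul_sq hb).mul_bdd (c := 1) (by fun_prop)
    (Eventually.of_forall fun u => Real.abs_sin_le_one _)

/-- The derivative of e^{-bu²} sin(2uv) has integral 0, which reduces the sine integral to the
cosine one. -/
lemma integral_gaussian_mul_sin {b : ℝ} (hb : 0 < b) (v : ℝ) :
    ∫ u : ℝ, u * Real.exp (-b * u ^ 2) * Real.sin (2 * u * v) =
      v / b * (Real.sqrt (Real.pi / b) * Real.exp (-v ^ 2 / b)) := by
  obtain ⟨hci, hcv⟩ := integral_gaussian_mul_cos hb v
  have hsi := integrable_gaussian_mul_sin hb v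
  have hd : ∀ u : ℝ, HasDerivAt (fun u => Real.exp (-b * u ^ 2) * Real.sin (2 * u * v))
      (2 * v * (Real.exp (-b * u ^ 2) * Real.cos (2 * u * v)) -
        2 * b * (u * Real.exp (-b * u ^ 2) * Real.sin (2 * u * v))) u := by
    intro u
    have h1 : HasDerivAt (fun u : ℝ => -b * u ^ 2) (-b * (2 * u)) u := by
      simpa using (hasDerivAt_pow 2 u).const_mul (-b)
    have h2 : HasDerivAt (fun u : ℝ => 2 * u * v) (2 * v) u := by
      simpa using ((hasDerivAt_id u).const_mul 2).mul_const v
    refine (h1.exp.mul h2.sin).congr_deriv ?_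
    ring
  have h0 := integral_eq_zero_of_hasDerivAt_of_integrable hd
    ((hci.const_mul _).sub (hsi.const_mul _))
    ((integrable_exp_neg_mul_sq hb).mul_bdd (c := 1) (by fun_prop)
      (Eventually.of_forall fun u => Real.abs_sin_le_one _))
  rw [integral_sub (hci.const_mul _) (hsi.const_mul _), integral_const_mul, integral_const_mul,
    hcv] at h0
  field_simp at h0 ⊢
  linarith

lemma integral_abs_mul_gaussian {b : ℝ} (hb : 0 < b) :
    Integrable (fun u : ℝ => |u| * Real.exp (-b * u ^ 2)) ∧
      ∫ u : ℝ, |u| * Real.exp (-b * u ^ 2) = b⁻¹ := by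
  constructor
  · have := (integrable_mul_exp_neg_mul_sq hb).norm
    simpa [norm_mul, abs_of_pos (Real.exp_pos _)] using this
  · have h1 := integral_comp_abs (f := fun u : ℝ => u * Real.exp (-b * u ^ 2))
    simp only [sq_abs] at h1
    have h2 := integral_mul_cexp_neg_mul_sq (b := (b : ℂ)) (by simpa using hb)
    have h3 : ∫ u : ℝ in Ioi 0, u * Real.exp (-b * u ^ 2) = (2 * b)⁻¹ := by
      rw [← Complex.ofReal_inj, ← integral_complex_ofReal]
      push_cast
      exact h2
    rw [h1, h3]
    field_simp

/-- The one-dimensional sine formula has density u times the same nonnegative kernel, and |u| times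
that kernel has mass 1; the prefactor 1/(v√π) remains. -/
lemma abs_diffMean_sqrt_mul_exp_le {n : ℕ} (hn : n ≠ 0) {v : ℝ} (hv : 0 < v) :
    |diffMean n (fun j => Real.sqrt j * Real.exp (-(j * v ^ 2)))| ≤
      (v * Real.sqrt Real.pi)⁻¹ := by
  set W : ℝ → ℝ := fun u => diffMean n (fun j => (j : ℝ)⁻¹ * Real.exp (-u ^ 2 / j)) with hW
  have hWnn : ∀ u, 0 ≤ W u := fun u => by
    simpa only [hW, neg_div] using diffMean_inv_mul_exp_nonneg hn (sq_nonneg u)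
  have hrew : ∀ (j : ℕ) (u : ℝ), Real.exp (-u ^ 2 / j) = Real.exp (-(j : ℝ)⁻¹ * u ^ 2) := by
    intro j u
    rw [show -(j : ℝ)⁻¹ * u ^ 2 = -u ^ 2 / j by ring]
  have hrep : diffMean n (fun j => Real.sqrt j * Real.exp (-(j * v ^ 2))) =
      ∫ u : ℝ, (v * Real.sqrt Real.pi)⁻¹ * (u * Real.sin (2 * u * v)) * W u := by
    rw [diffMean_congr hn (χ := fun j => ∫ u : ℝ, (v * Real.sqrt Real.pi)⁻¹ *
      (u * Real.sin (2 * u * v)) * ((j : ℝ)⁻¹ * Real.exp (-u ^ 2 / j))), diffMean_integral hn]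
    · simp only [diffMean_const_mul, hW]
    · intro j hj
      have hj0 : (0 : ℝ) < j := by exact_mod_cast hj
      convert (integrable_gaussian_mul_sin (inv_pos.mpr hj0) v).const_mul
        ((v * Real.sqrt Real.pi)⁻¹ * (j : ℝ)⁻¹) using 2 with u
      rw [hrew]
      ring
    · intro j hj
      have hj0 : (0 : ℝ) < j := by exact_mod_cast hj
      have e : ∀ u : ℝ, (v * Real.sqrt Real.pi)⁻¹ * (u * Real.sin (2 * u * v)) *
          ((j : ℝ)⁻¹ * Real.exp (-u ^ 2 / j)) = ((v * Real.sqrt Real.pi)⁻¹ * (j : ℝ)⁻¹) *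
          (u * Real.exp (-(j : ℝ)⁻¹ * u ^ 2) * Real.sin (2 * u * v)) := by
        intro u
        rw [hrew]
        ring
      simp only [e]
      rw [integral_const_mul, integral_gaussian_mul_sin (inv_pos.mpr hj0), div_inv_eq_mul,
        div_inv_eq_mul, div_inv_eq_mul, Real.sqrt_mul Real.pi_pos.le,
        show -v ^ 2 * (j : ℝ) = -(j * v ^ 2) by ring]
      have := Real.sqrt_pos.mpr Real.pi_pos
      field_simp
  have hint : Integrable (fun u : ℝ => |u| * W u) := by
    have := diffMean_integrable hn (ψ := fun j u => |u| * ((j : ℝ)⁻¹ * Real.exp (-u ^ 2 / j)))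
      (μ := volume) (fun j hj => by
        have hj0 : (0 : ℝ) < j := by exact_mod_cast hj
        convert (integral_abs_mul_gaussian (inv_pos.mpr hj0)).1.const_mul (j : ℝ)⁻¹ using 2 with u
        rw [hrew]
        ring)
    simpa only [diffMean_const_mul] using this
  have hone : ∫ u : ℝ, |u| * W u = 1 := by
    have h1 : diffMean n (fun _ => 1) =
        diffMean n (fun j => ∫ u : ℝ, |u| * ((j : ℝ)⁻¹ * Real.exp (-u ^ 2 / j))) := by
      refine diffMean_congr hn fun j hj => ?_
      have hj0 : (0 : ℝ) < j := by exact_mod_cast hj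
      have e : ∀ u : ℝ, |u| * ((j : ℝ)⁻¹ * Real.exp (-u ^ 2 / j)) =
          (j : ℝ)⁻¹ * (|u| * Real.exp (-(j : ℝ)⁻¹ * u ^ 2)) := by
        intro u
        rw [hrew]
        ring
      simp only [e]
      rw [integral_const_mul, (integral_abs_mul_gaussian (inv_pos.mpr hj0)).2]
      field_simp
    rw [diffMean_one, diffMean_integral hn] at h1
    · simp only [diffMean_const_mul] at h1
      exact h1.symm
    · intro j hj
      have hj0 : (0 : ℝ) < j := by exact_mod_cast hj
      convert (integral_abs_mul_gaussian (inv_pos.mpr hj0)).1.const_mul (j : ℝ)⁻¹ using 2 with u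
      rw [hrew]
      ring
  rw [hrep, ← Real.norm_eq_abs]
  have hb : ∫ u : ℝ, (v * Real.sqrt Real.pi)⁻¹ * (|u| * W u) = (v * Real.sqrt Real.pi)⁻¹ := by
    rw [integral_const_mul, hone, mul_one]
  refine le_of_le_of_eq ?_ hb
  refine norm_integral_le_of_norm_le (hint.const_mul _) (Eventually.of_forall fun u => ?_)
  rw [norm_mul, norm_mul, norm_mul, Real.norm_of_nonneg (hWnn u),
    Real.norm_of_nonneg (by positivity : 0 ≤ (v * Real.sqrt Real.pi)⁻¹), mul_assoc]
  have h1 : ‖Real.sin (2 * u * v)‖ ≤ 1 := Real.abs_sin_le_one _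
  have h2 := hWnn u
  rw [Real.norm_eq_abs u]
  gcongr
  exact mul_le_of_le_one_right (abs_nonneg u) h1

/-! ### The central binomial weight as a Laplace transform -/

lemma hasDerivAt_neg_mul (c t : ℝ) : HasDerivAt (fun t : ℝ => -(c * t)) (-c) t := by
  refine ((hasDerivAt_id t).const_mul c).neg.congr_deriv ?_
  simp

lemma exp_sub_one_pos {t : ℝ} (ht : 0 < t) : 0 < Real.exp t - 1 := by
  linarith [Real.add_one_lt_exp ht.ne']

lemma hasDerivAt_sqrt_exp_sub_one {t : ℝ} (ht : 0 < t) :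
    HasDerivAt (fun t => Real.sqrt (Real.exp t - 1))
      (Real.exp t / (2 * Real.sqrt (Real.exp t - 1))) t :=
  ((Real.hasDerivAt_exp t).sub_const 1).sqrt (exp_sub_one_pos ht).ne'

lemma tendsto_sqrt_exp_sub_one : Tendsto (fun t => Real.sqrt (Real.exp t - 1)) atTop atTop :=
  Real.tendsto_sqrt_atTop.comp (tendsto_atTop_add_const_right _ (-1) Real.tendsto_exp_atTop)

lemma integral_inv_sqrt_exp_sub_one :
    IntegrableOn (fun t => (Real.sqrt (Real.exp t - 1))⁻¹) (Ioi 0) ∧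
      ∫ t in Ioi 0, (Real.sqrt (Real.exp t - 1))⁻¹ = Real.pi := by
  have hc : ContinuousWithinAt (fun t => 2 * Real.arctan (Real.sqrt (Real.exp t - 1)))
      (Ici 0) 0 := by
    apply Continuous.continuousWithinAt
    fun_prop
  have hd : ∀ t ∈ Ioi (0 : ℝ), HasDerivAt
      (fun t => 2 * Real.arctan (Real.sqrt (Real.exp t - 1)))
      (Real.sqrt (Real.exp t - 1))⁻¹ t := by
    intro t ht
    have hp := exp_sub_one_pos ht
    refine ((hasDerivAt_sqrt_exp_sub_one ht).arctan.const_mul 2).congr_deriv ?_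
    rw [Real.sq_sqrt hp.le]
    have := Real.exp_pos t
    have := Real.sqrt_pos.mpr hp
    rw [show 1 + (Real.exp t - 1) = Real.exp t by ring]
    field_simp
  have hl : Tendsto (fun t => 2 * Real.arctan (Real.sqrt (Real.exp t - 1))) atTop
      (𝓝 (2 * (Real.pi / 2))) :=
    ((Real.tendsto_arctan_atTop.mono_right nhdsWithin_le_nhds).comp
      tendsto_sqrt_exp_sub_one).const_mul 2
  have hnn : ∀ t ∈ Ioi (0 : ℝ), 0 ≤ (Real.sqrt (Real.exp t - 1))⁻¹ := fun t _ => by positivity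
  refine ⟨integrableOn_Ioi_deriv_of_nonneg hc hd hnn hl, ?_⟩
  rw [integral_Ioi_of_hasDerivAt_of_nonneg hc hd hnn hl]
  simp
  ring

lemma integrableOn_exp_mul_inv_sqrt (j : ℕ) :
    IntegrableOn (fun t => Real.exp (-(j * t)) * (Real.sqrt (Real.exp t - 1))⁻¹) (Ioi 0) := by
  refine integral_inv_sqrt_exp_sub_one.1.bdd_mul (c := 1) (by fun_prop) ?_
  filter_upwards [ae_restrict_mem measurableSet_Ioi] with t ht
  have ht' : (0 : ℝ) < t := ht
  rw [Real.norm_of_nonneg (Real.exp_pos _).le, Real.exp_le_one_iff]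
  have : 0 ≤ (j : ℝ) * t := by positivity
  linarith

/-- Integrate the derivative of e^{-(j+1)t} √(e^t - 1), which vanishes at both ends. This is the
recursion of the central binomial coefficients. -/
lemma integral_exp_mul_inv_sqrt_succ (j : ℕ) :
    ((j : ℝ) + 1) *
      ∫ t in Ioi 0, Real.exp (-((j + 1 : ℕ) * t)) * (Real.sqrt (Real.exp t - 1))⁻¹ =
    ((j : ℝ) + 1 / 2) * ∫ t in Ioi 0, Real.exp (-(j * t)) * (Real.sqrt (Real.exp t - 1))⁻¹ := by
  have hi := integrableOn_exp_mul_inv_sqrt j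
  have hi' := integrableOn_exp_mul_inv_sqrt (j + 1)
  have hd : ∀ t ∈ Ioi (0 : ℝ), HasDerivAt
      (fun t => Real.exp (-((j + 1 : ℕ) * t)) * Real.sqrt (Real.exp t - 1))
      (((j : ℝ) + 1) * (Real.exp (-((j + 1 : ℕ) * t)) * (Real.sqrt (Real.exp t - 1))⁻¹) -
        ((j : ℝ) + 1 / 2) * (Real.exp (-(j * t)) * (Real.sqrt (Real.exp t - 1))⁻¹)) t := by
    intro t ht
    have hp := exp_sub_one_pos ht
    have h1 := hasDerivAt_neg_mul ((j + 1 : ℕ) : ℝ) t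
    refine (h1.exp.mul (hasDerivAt_sqrt_exp_sub_one ht)).congr_deriv ?_
    have hs := Real.sqrt_pos.mpr hp
    have hsq := Real.sq_sqrt hp.le
    have he : Real.exp (-(j * t)) = Real.exp (-((j + 1 : ℕ) * t)) * Real.exp t := by
      rw [← Real.exp_add]
      push_cast
      ring_nf
    rw [he]
    push_cast
    field_simp
    rw [hsq]
    ring
  have hl : Tendsto (fun t => Real.exp (-((j + 1 : ℕ) * t)) * Real.sqrt (Real.exp t - 1)) atTop
      (𝓝 0) := by
    have h2 : Tendsto (fun t : ℝ => Real.exp (-(t / 2))) atTop (𝓝 0) :=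
      Real.tendsto_exp_neg_atTop_nhds_zero.comp (tendsto_id.atTop_div_const two_pos)
    refine squeeze_zero' (Eventually.of_forall fun t => by positivity) ?_ h2
    filter_upwards [eventually_ge_atTop 0] with t ht
    have h3 : Real.sqrt (Real.exp t - 1) ≤ Real.exp (t / 2) := by
      rw [Real.exp_half]
      exact Real.sqrt_le_sqrt (by linarith)
    have h4 : Real.exp (-((j + 1 : ℕ) * t)) ≤ Real.exp (-t) := by
      rw [Real.exp_le_exp]
      push_cast
      nlinarith [mul_nonneg (Nat.cast_nonneg (α := ℝ) j) ht]
    calc _ ≤ Real.exp (-t) * Real.exp (t / 2) := by gcongr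
      _ = _ := by rw [← Real.exp_add]; ring_nf
  have := integral_Ioi_of_hasDerivAt_of_tendsto
    (Continuous.continuousWithinAt (by fun_prop)) hd
    ((hi'.const_mul _).sub (hi.const_mul _)) hl
  rw [integral_sub (hi'.const_mul _) (hi.const_mul _), integral_const_mul, integral_const_mul] at this
  simp at this
  push_cast
  linarith

lemma integral_exp_mul_inv_sqrt (j : ℕ) :
    ∫ t in Ioi 0, Real.exp (-(j * t)) * (Real.sqrt (Real.exp t - 1))⁻¹ =
      Real.pi * ((2 * j).choose j / 4 ^ j : ℝ) := by
  induction j with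
  | zero => simpa using integral_inv_sqrt_exp_sub_one.2
  | succ j ih =>
    have h := integral_exp_mul_inv_sqrt_succ j
    rw [ih] at h
    have h2 : ((j : ℝ) + 1) * (2 * (j + 1)).choose (j + 1) = 2 * (2 * j + 1) * (2 * j).choose j := by
      exact_mod_cast Nat.succ_mul_centralBinom_succ j
    have h3 : (j : ℝ) + 1 ≠ 0 := by positivity
    refine mul_left_cancel₀ h3 (h.trans ?_)
    rw [pow_succ]
    have : (0 : ℝ) < 4 ^ j := by positivity
    field_simp
    linear_combination (-2 : ℝ) * h2

/-! ### Comparison of 1/√(e^t - 1) with 1/√t -/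

lemma exp_sub_one_le_mul_exp (t : ℝ) : Real.exp t - 1 ≤ t * Real.exp t := by
  have h : Real.exp (-t) * Real.exp t = 1 := by rw [← Real.exp_add]; simp
  nlinarith [Real.one_sub_le_exp_neg t, Real.exp_pos t]

lemma inv_sqrt_mul_exp_half_le {t : ℝ} (ht : 0 < t) :
    (Real.sqrt t)⁻¹ * Real.exp (-(t / 2)) ≤ (Real.sqrt (Real.exp t - 1))⁻¹ := by
  have hp := exp_sub_one_pos ht
  rw [Real.exp_neg, ← mul_inv]
  refine inv_anti₀ (Real.sqrt_pos.mpr hp) ?_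
  rw [Real.exp_half, ← Real.sqrt_mul ht.le]
  exact Real.sqrt_le_sqrt (exp_sub_one_le_mul_exp t)

lemma inv_sqrt_exp_sub_one_le {t : ℝ} (ht : 0 < t) :
    (Real.sqrt (Real.exp t - 1))⁻¹ ≤ (Real.sqrt t)⁻¹ :=
  inv_anti₀ (Real.sqrt_pos.mpr ht) (Real.sqrt_le_sqrt (by linarith [Real.add_one_le_exp t]))

/-- The derivative of `t ↦ 1/√t - 1/√(eᵗ - 1)`. -/
noncomputable def invSqrtDefectDeriv (t : ℝ) : ℝ :=
  Real.exp t / (2 * (Real.exp t - 1)) * (Real.sqrt (Real.exp t - 1))⁻¹ -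
    1 / (2 * t) * (Real.sqrt t)⁻¹

lemma hasDerivAt_inv_sqrt {t : ℝ} (ht : 0 < t) :
    HasDerivAt (fun t => (Real.sqrt t)⁻¹) (-(1 / (2 * t) * (Real.sqrt t)⁻¹)) t := by
  refine ((Real.hasDerivAt_sqrt ht.ne').inv (Real.sqrt_pos.mpr ht).ne').congr_deriv ?_
  rw [Real.sq_sqrt ht.le]
  have := Real.sqrt_pos.mpr ht
  field_simp

lemma hasDerivAt_inv_sqrt_exp_sub_one {t : ℝ} (ht : 0 < t) :
    HasDerivAt (fun t => (Real.sqrt (Real.exp t - 1))⁻¹)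
      (-(Real.exp t / (2 * (Real.exp t - 1)) * (Real.sqrt (Real.exp t - 1))⁻¹)) t := by
  have hp := exp_sub_one_pos ht
  have := Real.sqrt_pos.mpr hp
  refine ((hasDerivAt_sqrt_exp_sub_one ht).inv this.ne').congr_deriv ?_
  rw [Real.sq_sqrt hp.le]
  field_simp

lemma hasDerivAt_invSqrtDefect {t : ℝ} (ht : 0 < t) :
    HasDerivAt (fun t => (Real.sqrt t)⁻¹ - (Real.sqrt (Real.exp t - 1))⁻¹)
      (invSqrtDefectDeriv t) t := by
  refine ((hasDerivAt_inv_sqrt ht).sub (hasDerivAt_inv_sqrt_exp_sub_one ht)).congr_deriv ?_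
  rw [invSqrtDefectDeriv]
  ring

/-- The t^{-3/2} singularities of the two terms cancel, leaving order t^{-1/2}, which is integrable
at 0. -/
lemma abs_invSqrtDefectDeriv_le {t : ℝ} (ht : 0 < t) (ht1 : t ≤ 1) :
    |invSqrtDefectDeriv t| ≤ 2 * (Real.sqrt t)⁻¹ := by
  have hp := exp_sub_one_pos ht
  have hs := Real.sqrt_pos.mpr ht
  have hsp := Real.sqrt_pos.mpr hp
  have he : Real.exp t ≤ 3 := by
    have := Real.exp_le_exp.mpr ht1
    linarith [Real.exp_one_lt_d9]
  rw [invSqrtDefectDeriv, abs_le]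
  constructor
  · have h1 : 1 / (2 * t) ≤ Real.exp t / (2 * (Real.exp t - 1)) := by
      rw [div_le_div_iff₀ (by positivity) (by positivity)]
      linarith [exp_sub_one_le_mul_exp t]
    have h2 : 1 / (2 * t) * ((Real.sqrt t)⁻¹ * Real.exp (-(t / 2))) ≤
        Real.exp t / (2 * (Real.exp t - 1)) * (Real.sqrt (Real.exp t - 1))⁻¹ := by
      have := inv_sqrt_mul_exp_half_le ht
      gcongr
    have h3 : 1 / (2 * t) * ((Real.sqrt t)⁻¹ * (1 - t / 2)) ≤
        1 / (2 * t) * ((Real.sqrt t)⁻¹ * Real.exp (-(t / 2))) := by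
      have := Real.one_sub_le_exp_neg (t / 2)
      gcongr
    have h4 : 1 / (2 * t) * ((Real.sqrt t)⁻¹ * (1 - t / 2)) =
        1 / (2 * t) * (Real.sqrt t)⁻¹ - (Real.sqrt t)⁻¹ / 4 := by
      field_simp
      ring
    have h5 : 0 < (Real.sqrt t)⁻¹ := by positivity
    linarith
  · have h1 : Real.exp t / (2 * (Real.exp t - 1)) ≤ Real.exp t / (2 * t) := by
      have := Real.add_one_le_exp t
      gcongr
      linarith
    have h2 : Real.exp t / (2 * (Real.exp t - 1)) * (Real.sqrt (Real.exp t - 1))⁻¹ ≤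
        Real.exp t / (2 * t) * (Real.sqrt t)⁻¹ := by
      have := inv_sqrt_exp_sub_one_le ht
      gcongr
    have h3 : Real.exp t / (2 * t) * (Real.sqrt t)⁻¹ - 1 / (2 * t) * (Real.sqrt t)⁻¹ =
        (Real.exp t - 1) / (2 * t) * (Real.sqrt t)⁻¹ := by ring
    have h4 : (Real.exp t - 1) / (2 * t) ≤ 2 := by
      rw [div_le_iff₀ (by positivity)]
      nlinarith [exp_sub_one_le_mul_exp t]
    have h5 : (Real.exp t - 1) / (2 * t) * (Real.sqrt t)⁻¹ ≤ 2 * (Real.sqrt t)⁻¹ := by gcongr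
    linarith

lemma integrableOn_invSqrtDefectDeriv : IntegrableOn invSqrtDefectDeriv (Ioi 0) := by
  rw [← Ioc_union_Ioi_eq_Ioi zero_le_one]
  have hmeas : Measurable invSqrtDefectDeriv := by
    unfold invSqrtDefectDeriv
    fun_prop
  refine IntegrableOn.union ?_ ?_
  · have h1 : IntegrableOn (fun t : ℝ => 2 * (Real.sqrt t)⁻¹) (Ioc 0 1) := by
      have h2 : IntervalIntegrable (fun t : ℝ => t ^ (-(1 / 2) : ℝ)) volume 0 1 :=
        intervalIntegral.intervalIntegrable_rpow' (by norm_num)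
      rw [intervalIntegrable_iff_integrableOn_Ioc_of_le zero_le_one] at h2
      refine IntegrableOn.congr_fun (h2.const_mul 2) (fun t ht => ?_) measurableSet_Ioc
      rw [Real.rpow_neg ht.1.le, Real.sqrt_eq_rpow]
    refine h1.mono' hmeas.aestronglyMeasurable ?_
    filter_upwards [ae_restrict_mem measurableSet_Ioc] with t ht
    exact abs_invSqrtDefectDeriv_le ht.1 ht.2
  -- Beyond 1 no cancellation is needed: each term is, up to sign, the derivative of a decreasing
  -- function with limit 0.
  · have hpos : ∀ t ∈ Ici (1 : ℝ), 0 < t := fun t ht => lt_of_lt_of_le one_pos ht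
    refine IntegrableOn.sub ?_ ?_
    · have := integrableOn_Ioi_deriv_of_nonpos' (a := 1)
        (fun t ht => hasDerivAt_inv_sqrt_exp_sub_one (hpos t ht))
        (fun t ht => by
          have := exp_sub_one_pos (hpos t (Ioi_subset_Ici_self ht))
          rw [neg_nonpos]
          positivity)
        (tendsto_inv_atTop_zero.comp tendsto_sqrt_exp_sub_one)
      simpa using this.neg
    · have := integrableOn_Ioi_deriv_of_nonpos' (a := 1)
        (fun t ht => hasDerivAt_inv_sqrt (hpos t ht))
        (fun t ht => by
          have := hpos t (Ioi_subset_Ici_self ht)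
          rw [neg_nonpos]
          positivity)
        (tendsto_inv_atTop_zero.comp Real.tendsto_sqrt_atTop)
      simpa using this.neg

lemma integral_exp_mul_inv_sqrt_self {j : ℕ} (hj : 1 ≤ j) :
    IntegrableOn (fun t => Real.exp (-(j * t)) * (Real.sqrt t)⁻¹) (Ioi 0) ∧
      ∫ t in Ioi 0, Real.exp (-(j * t)) * (Real.sqrt t)⁻¹ = Real.sqrt (Real.pi / j) := by
  have hj0 : (0 : ℝ) < j := by exact_mod_cast hj
  have h := Real.integral_rpow_mul_exp_neg_mul_Ioi (a := 1 / 2) (by norm_num) hj0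
  have e : ∀ t ∈ Ioi (0 : ℝ), t ^ ((1 / 2 : ℝ) - 1) * Real.exp (-(j * t)) =
      Real.exp (-(j * t)) * (Real.sqrt t)⁻¹ := by
    intro t ht
    rw [show (1 / 2 : ℝ) - 1 = -(1 / 2) by norm_num, Real.rpow_neg (le_of_lt ht),
      Real.sqrt_eq_rpow, mul_comm]
  rw [setIntegral_congr_fun measurableSet_Ioi e] at h
  have h2 : ∫ t in Ioi 0, Real.exp (-(j * t)) * (Real.sqrt t)⁻¹ = Real.sqrt (Real.pi / j) := by
    rw [h, Real.Gamma_one_half_eq, ← Real.sqrt_eq_rpow, ← Real.sqrt_mul (by positivity)]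
    congr 1
    ring
  refine ⟨?_, h2⟩
  -- A nonintegrable function has integral 0 by convention, which contradicts the positive value
  -- just found.
  by_contra hn
  rw [integral_undef hn] at h2
  have : 0 < Real.sqrt (Real.pi / j) := Real.sqrt_pos.mpr (by have := Real.pi_pos; positivity)
  linarith

lemma integrableOn_exp_mul_invSqrtDefectDeriv {c : ℝ} (hc : 0 ≤ c) :
    IntegrableOn (fun t => Real.exp (-(c * t)) * invSqrtDefectDeriv t) (Ioi 0) := by
  refine integrableOn_invSqrtDefectDeriv.bdd_mul (c := 1) (by fun_prop) ?_
  filter_upwards [ae_restrict_mem measurableSet_Ioi] with t ht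
  have ht' : (0 : ℝ) < t := ht
  rw [Real.norm_of_nonneg (Real.exp_pos _).le, Real.exp_le_one_iff]
  have : 0 ≤ c * t := by positivity
  linarith

/-- Integrate by parts the Laplace transform of 1/√t - 1/√(e^t - 1), so that the factor j is
absorbed by a derivative. The boundary terms vanish, and 1/√t contributes the main term √(πj). -/
lemma mul_centralBinom_eq {j : ℕ} (hj : 1 ≤ j) :
    (j : ℝ) * ((2 * j).choose j / 4 ^ j : ℝ) = (Real.sqrt Real.pi)⁻¹ * Real.sqrt j -
      Real.pi⁻¹ * ∫ t in Ioi 0, Real.exp (-(j * t)) * invSqrtDefectDeriv t := by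
  have hj0 : (0 : ℝ) < j := by exact_mod_cast hj
  obtain ⟨hi1, hv1⟩ := integral_exp_mul_inv_sqrt_self hj
  have hi2 := integrableOn_exp_mul_inv_sqrt j
  have hv2 := integral_exp_mul_inv_sqrt j
  have hi3 := integrableOn_exp_mul_invSqrtDefectDeriv hj0.le
  set G : ℝ → ℝ := fun t => Real.exp (-(j * t)) *
    ((Real.sqrt t)⁻¹ - (Real.sqrt (Real.exp t - 1))⁻¹) with hG
  have hd : ∀ t ∈ Ioi (0 : ℝ), HasDerivAt G (Real.exp (-(j * t)) * invSqrtDefectDeriv t -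
      j * (Real.exp (-(j * t)) * (Real.sqrt t)⁻¹ -
        Real.exp (-(j * t)) * (Real.sqrt (Real.exp t - 1))⁻¹)) t := by
    intro t ht
    have h1 := hasDerivAt_neg_mul (j : ℝ) t
    refine (h1.exp.mul (hasDerivAt_invSqrtDefect ht)).congr_deriv ?_
    ring
  have hG0 : ∀ t, 0 < t → 0 ≤ G t := fun t ht =>
    mul_nonneg (Real.exp_pos _).le (sub_nonneg.mpr (inv_sqrt_exp_sub_one_le ht))
  have hexp : ∀ t : ℝ, 0 < t → Real.exp (-(j * t)) ≤ 1 := fun t ht => by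
    rw [Real.exp_le_one_iff]
    have : 0 ≤ (j : ℝ) * t := by positivity
    linarith
  have hG1 : ∀ t, 0 < t → G t ≤ Real.sqrt t := by
    intro t ht
    have h1 := inv_sqrt_mul_exp_half_le ht
    have h2 := Real.one_sub_le_exp_neg (t / 2)
    have hs := Real.sqrt_pos.mpr ht
    have h3 : (Real.sqrt t)⁻¹ - (Real.sqrt (Real.exp t - 1))⁻¹ ≤ Real.sqrt t / 2 := by
      have h4 : (Real.sqrt t)⁻¹ * (1 - t / 2) ≤ (Real.sqrt t)⁻¹ * Real.exp (-(t / 2)) := by gcongr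
      have h5 : (Real.sqrt t)⁻¹ * (1 - t / 2) = (Real.sqrt t)⁻¹ - Real.sqrt t / 2 := by
        have := Real.sq_sqrt ht.le
        field_simp
        linarith
      linarith
    have h6 := sub_nonneg.mpr (inv_sqrt_exp_sub_one_le ht)
    calc G t ≤ 1 * (Real.sqrt t / 2) := mul_le_mul (hexp t ht) h3 h6 zero_le_one
      _ ≤ Real.sqrt t := by linarith
  have hG2 : ∀ t, 0 < t → G t ≤ (Real.sqrt t)⁻¹ := by
    intro t ht
    have h6 := sub_nonneg.mpr (inv_sqrt_exp_sub_one_le ht)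
    calc G t ≤ 1 * (Real.sqrt t)⁻¹ :=
          mul_le_mul (hexp t ht) (sub_le_self _ (by positivity)) h6 zero_le_one
      _ = _ := one_mul _
  have hGz : G 0 = 0 := by simp [hG]
  have hcont : ContinuousWithinAt G (Ici 0) 0 := by
    rw [← continuousWithinAt_Ioi_iff_Ici, ContinuousWithinAt, hGz]
    have h1 : Tendsto Real.sqrt (𝓝[>] 0) (𝓝 0) := by
      have := (Real.continuous_sqrt.tendsto 0).mono_left (nhdsWithin_le_nhds (s := Ioi 0))
      simpa using this
    exact squeeze_zero' (eventually_nhdsWithin_of_forall hG0)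
      (eventually_nhdsWithin_of_forall hG1) h1
  have hlim : Tendsto G atTop (𝓝 0) :=
    squeeze_zero' ((eventually_gt_atTop 0).mono hG0) ((eventually_gt_atTop 0).mono hG2)
      (tendsto_inv_atTop_zero.comp Real.tendsto_sqrt_atTop)
  have h := integral_Ioi_of_hasDerivAt_of_tendsto hcont hd
    (hi3.sub ((hi1.sub hi2).const_mul _)) hlim
  have hi12 : IntegrableOn (fun t => (j : ℝ) * (Real.exp (-(j * t)) * (Real.sqrt t)⁻¹ -
      Real.exp (-(j * t)) * (Real.sqrt (Real.exp t - 1))⁻¹)) (Ioi 0) :=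
    (hi1.sub hi2).const_mul _
  rw [integral_sub hi3 hi12, integral_const_mul, integral_sub hi1 hi2,
    hv1, hv2, hGz] at h
  have hpi := Real.pi_pos
  have hsp := Real.sqrt_pos.mpr hpi
  have h7 : (j : ℝ) * Real.sqrt (Real.pi / j) = Real.pi * ((Real.sqrt Real.pi)⁻¹ * Real.sqrt j) := by
    rw [Real.sqrt_div hpi.le]
    have h8 := Real.sq_sqrt hpi.le
    have h9 := Real.sq_sqrt hj0.le
    have h10 := Real.sqrt_pos.mpr hj0
    field_simp
    rw [h8, h9]
  have h8 : Real.pi * ((j : ℝ) * ((2 * j).choose j / 4 ^ j : ℝ)) =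
      Real.pi * ((Real.sqrt Real.pi)⁻¹ * Real.sqrt j -
        Real.pi⁻¹ * ∫ t in Ioi 0, Real.exp (-(j * t)) * invSqrtDefectDeriv t) := by
    rw [mul_sub, mul_inv_cancel_left₀ hpi.ne', ← h7]
    linarith
  exact mul_left_cancel₀ hpi.ne' h8

/-! ### Uniform and geometric bounds with the central binomial weight -/

lemma exists_abs_diffMean_centralBinom_le :
    ∃ C : ℝ, 0 ≤ C ∧ ∀ (n : ℕ), n ≠ 0 → ∀ w : ℝ, 0 < w → w < 1 →
      |diffMean n (fun j => j * ((2 * j).choose j / 4 ^ j : ℝ) * w ^ j)| ≤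
        C * (Real.sqrt (1 - w))⁻¹ := by
  have hpi := Real.pi_pos
  have hsp := Real.sqrt_pos.mpr hpi
  set B := ∫ t in Ioi 0, ‖invSqrtDefectDeriv t‖ with hB
  have hB0 : 0 ≤ B := integral_nonneg fun _ => norm_nonneg _
  refine ⟨Real.pi⁻¹ + Real.pi⁻¹ * B, by positivity, fun n hn w hw hw1 => ?_⟩
  -- Then w = e^{-v²}, and v ≥ √(1-w) converts the bound in 1/v into the stated one.
  set v := Real.sqrt (-Real.log w) with hv
  have hlog : Real.log w < 0 := Real.log_neg hw hw1
  have hv0 : 0 < v := Real.sqrt_pos.mpr (by linarith)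
  have hv2 : v ^ 2 = -Real.log w := Real.sq_sqrt (by linarith)
  have hwj : ∀ j : ℕ, w ^ j = Real.exp (-(j * v ^ 2)) := by
    intro j
    rw [hv2, ← Real.exp_log (pow_pos hw j), Real.log_pow]
    ring_nf
  have hs0 : 0 < Real.sqrt (1 - w) := Real.sqrt_pos.mpr (by linarith)
  have hsv : Real.sqrt (1 - w) ≤ v :=
    Real.sqrt_le_sqrt (by linarith [Real.log_le_sub_one_of_pos hw])
  have hs1 : Real.sqrt (1 - w) ≤ 1 := by
    exact Real.sqrt_le_one.mpr (by linarith)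
  have hint : ∀ j : ℕ, 1 ≤ j → Integrable
      (fun t => invSqrtDefectDeriv t * Real.exp (-(j * (t + v ^ 2)))) (volume.restrict (Ioi 0)) := by
    intro j hj
    have := (integrableOn_exp_mul_invSqrtDefectDeriv (Nat.cast_nonneg (α := ℝ) j)).const_mul
      (Real.exp (-(j * v ^ 2)))
    refine this.congr (Eventually.of_forall fun t => ?_)
    simp only
    rw [mul_add, neg_add, Real.exp_add]
    ring
  have hrep : diffMean n (fun j => j * ((2 * j).choose j / 4 ^ j : ℝ) * w ^ j) =
      (Real.sqrt Real.pi)⁻¹ * diffMean n (fun j => Real.sqrt j * Real.exp (-(j * v ^ 2))) +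
      (-Real.pi⁻¹) * ∫ t in Ioi 0, invSqrtDefectDeriv t *
        diffMean n (fun j => Real.exp (-(j * (t + v ^ 2)))) := by
    simp only [← diffMean_const_mul]
    rw [← diffMean_integral hn hint, ← diffMean_const_mul, ← diffMean_add]
    refine diffMean_congr hn fun j hj => ?_
    rw [mul_centralBinom_eq hj, hwj]
    have : ∫ t in Ioi 0, invSqrtDefectDeriv t * Real.exp (-(j * (t + v ^ 2))) =
        Real.exp (-(j * v ^ 2)) *
          ∫ t in Ioi 0, Real.exp (-(j * t)) * invSqrtDefectDeriv t := by
      rw [← integral_const_mul]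
      congr 1
      ext t
      rw [mul_add, neg_add, Real.exp_add]
      ring
    rw [this]
    ring
  have h1 : |(Real.sqrt Real.pi)⁻¹ * diffMean n (fun j => Real.sqrt j * Real.exp (-(j * v ^ 2)))| ≤
      Real.pi⁻¹ * (Real.sqrt (1 - w))⁻¹ := by
    rw [abs_mul, abs_of_pos (inv_pos.mpr hsp)]
    calc _ ≤ (Real.sqrt Real.pi)⁻¹ * (v * Real.sqrt Real.pi)⁻¹ := by
          have := abs_diffMean_sqrt_mul_exp_le hn hv0
          gcongr
      _ = Real.pi⁻¹ * v⁻¹ := by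
          rw [← mul_inv, ← mul_inv]
          congr 1
          linear_combination v * Real.mul_self_sqrt hpi.le
      _ ≤ _ := by gcongr
  have h2 : |∫ t in Ioi 0, invSqrtDefectDeriv t *
        diffMean n (fun j => Real.exp (-(j * (t + v ^ 2))))| ≤ B := by
    rw [← Real.norm_eq_abs]
    refine norm_integral_le_of_norm_le integrableOn_invSqrtDefectDeriv.norm ?_
    filter_upwards [ae_restrict_mem measurableSet_Ioi] with t ht
    rw [norm_mul]
    refine mul_le_of_le_one_right (norm_nonneg _) ?_
    have ht' : (0 : ℝ) < t := ht
    exact abs_diffMean_exp_le hn (by positivity)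
  have h3 : 1 ≤ (Real.sqrt (1 - w))⁻¹ := (one_le_inv₀ hs0).mpr hs1
  rw [hrep]
  refine (abs_add_le _ _).trans ?_
  rw [abs_mul (-Real.pi⁻¹), abs_neg, abs_of_pos (inv_pos.mpr hpi), add_mul]
  refine add_le_add h1 ?_
  calc _ ≤ Real.pi⁻¹ * B := by gcongr
    _ ≤ _ := le_mul_of_one_le_right (by positivity) h3

lemma exists_abs_diffMean_centralBinom_le_geometric {w₀ : ℝ} (h0 : 0 < w₀) (h1 : w₀ < 1) :
    ∃ ρ C : ℝ, 0 ≤ ρ ∧ ρ < 1 ∧ 0 ≤ C ∧ ∀ (m : ℕ) (w : ℝ), 0 ≤ w → w ≤ w₀ →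
      |diffMean (m + 1) (fun j => j * ((2 * j).choose j / 4 ^ j : ℝ) * w ^ j)| ≤
        C * ((m + 1) * ρ ^ m) * w := by
  obtain ⟨ρ, C, hρ0, hρ1, hC, h⟩ := exists_abs_diffMean_mul_pow_le h0 h1
  refine ⟨ρ, C, hρ0, hρ1, hC, fun m w hw hw0 => ?_⟩
  have hpi := Real.pi_pos
  have hint : ∀ j : ℕ, 1 ≤ j → Integrable (fun t => (Real.sqrt (Real.exp t - 1))⁻¹ *
      (j * (w * Real.exp (-t)) ^ j)) (volume.restrict (Ioi 0)) := by
    intro j hj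
    refine ((integrableOn_exp_mul_inv_sqrt j).const_mul (j * w ^ j)).congr
      (Eventually.of_forall fun t => ?_)
    simp only
    rw [mul_pow, ← Real.exp_nat_mul, mul_neg]
    ring
  -- The weight is a mixture of the powers e^{-jt}, so the mean is an average over t of the
  -- unweighted ones at w e^{-t} ≤ w₀.
  have hrep : diffMean (m + 1) (fun j => j * ((2 * j).choose j / 4 ^ j : ℝ) * w ^ j) =
      Real.pi⁻¹ * ∫ t in Ioi 0, (Real.sqrt (Real.exp t - 1))⁻¹ *
        diffMean (m + 1) (fun j => j * (w * Real.exp (-t)) ^ j) := by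
    simp only [← diffMean_const_mul]
    rw [← diffMean_integral m.succ_ne_zero hint, ← diffMean_const_mul]
    congr 1
    ext j
    have : ∫ t in Ioi 0, (Real.sqrt (Real.exp t - 1))⁻¹ * (j * (w * Real.exp (-t)) ^ j) =
        (j * w ^ j) * ∫ t in Ioi 0, Real.exp (-(j * t)) * (Real.sqrt (Real.exp t - 1))⁻¹ := by
      rw [← integral_const_mul]
      congr 1
      ext t
      rw [mul_pow, ← Real.exp_nat_mul, mul_neg]
      ring
    rw [this, integral_exp_mul_inv_sqrt]
    field_simp
  have hb : |∫ t in Ioi 0, (Real.sqrt (Real.exp t - 1))⁻¹ *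
        diffMean (m + 1) (fun j => j * (w * Real.exp (-t)) ^ j)| ≤
      Real.pi * (C * ((m + 1) * ρ ^ m) * w) := by
    rw [← integral_inv_sqrt_exp_sub_one.2, ← integral_mul_const, ← Real.norm_eq_abs]
    refine norm_integral_le_of_norm_le (integral_inv_sqrt_exp_sub_one.1.mul_const _) ?_
    filter_upwards [ae_restrict_mem measurableSet_Ioi] with t ht
    have ht' : (0 : ℝ) < t := ht
    have he : Real.exp (-t) ≤ 1 := by rw [Real.exp_le_one_iff]; linarith
    have hwe : w * Real.exp (-t) ≤ w := mul_le_of_le_one_right hw he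
    rw [norm_mul, Real.norm_of_nonneg (by positivity)]
    gcongr
    calc _ ≤ C * ((m + 1) * ρ ^ m) * (w * Real.exp (-t)) :=
          h m _ (by positivity) (hwe.trans hw0)
      _ ≤ _ := by gcongr
  rw [hrep, abs_mul, abs_of_pos (inv_pos.mpr hpi)]
  calc _ ≤ Real.pi⁻¹ * (Real.pi * (C * ((m + 1) * ρ ^ m) * w)) := by gcongr
    _ = _ := by field_simp

/-! ### The kernel polynomial and the error integral -/

/-- The polynomial `∑ aₖ(n) yᵏ`. -/
noncomputable def gaverStehfestPoly (n : ℕ) (y : ℝ) : ℝ :=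
  ∑ k ∈ Finset.Icc 1 (2 * n), gaverStehfestCoeff n k * y ^ k

lemma continuous_gaverStehfestPoly (n : ℕ) : Continuous (gaverStehfestPoly n) := by
  unfold gaverStehfestPoly
  fun_prop

lemma gaverStehfestPoly_eq (n : ℕ) (y : ℝ) :
    gaverStehfestPoly n y =
      diffMean n (fun j => j * ((2 * j).choose j / 4 ^ j : ℝ) * (1 - (1 - 2 * y) ^ 2) ^ j) := by
  rw [gaverStehfestPoly, sum_gaverStehfestCoeff_pow]
  congr 2
  ext j
  ring

lemma gaverStehfest_eq_integral {f : ℝ → ℝ} (n : ℕ) {x c : ℝ} (hx : 0 < x)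
    (hc : c = Real.log 2 * x⁻¹)
    (hF : ∀ z : ℝ, 0 < z → IntegrableOn (fun t : ℝ => Real.exp (-z * t) * f t) (Ioi (0 : ℝ))) :
    IntegrableOn (fun t => c * gaverStehfestPoly n (Real.exp (-(c * t))) * f t) (Ioi 0) ∧
    gaverStehfest f n x =
      ∫ t in Ioi 0, c * gaverStehfestPoly n (Real.exp (-(c * t))) * f t := by
  have hc0 : 0 < c := hc ▸ mul_pos (Real.log_pos one_lt_two) (inv_pos.mpr hx)
  have e : ∀ t, c * gaverStehfestPoly n (Real.exp (-(c * t))) * f t =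
      ∑ k ∈ Finset.Icc 1 (2 * n), c * gaverStehfestCoeff n k *
        (Real.exp (-(k * Real.log 2 * x⁻¹) * t) * f t) := by
    intro t
    rw [gaverStehfestPoly, Finset.mul_sum, Finset.sum_mul]
    refine Finset.sum_congr rfl fun k _ => ?_
    rw [← Real.exp_nat_mul, hc]
    ring_nf
  have hi : ∀ k ∈ Finset.Icc 1 (2 * n), IntegrableOn (fun t => c * gaverStehfestCoeff n k *
        (Real.exp (-(k * Real.log 2 * x⁻¹) * t) * f t)) (Ioi 0) := by
    intro k hk
    have hk0 : (0 : ℝ) < k := by exact_mod_cast (Finset.mem_Icc.mp hk).1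
    refine (hF _ ?_).const_mul _
    rw [mul_assoc, ← hc]
    positivity
  simp only [e]
  refine ⟨integrable_finsetSum _ hi, ?_⟩
  rw [integral_finsetSum _ hi, gaverStehfest, ← hc, Finset.mul_sum]
  refine Finset.sum_congr rfl fun k _ => ?_
  rw [integral_const_mul, laplaceTransform]
  ring

lemma gaverStehfest_one {n : ℕ} (hn : n ≠ 0) {x : ℝ} (hx : 0 < x) :
    gaverStehfest (fun _ => 1) n x = 1 := by
  refine Eq.trans ?_ (sum_gaverStehfestCoeff_div hn)
  rw [gaverStehfest, Finset.mul_sum]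
  refine Finset.sum_congr rfl fun k hk => ?_
  have hk0 : (0 : ℝ) < k := by exact_mod_cast (Finset.mem_Icc.mp hk).1
  have hl := Real.log_pos one_lt_two
  have hz : 0 < (k : ℝ) * Real.log 2 * x⁻¹ := by positivity
  simp only [laplaceTransform, mul_one]
  rw [integral_exp_mul_Ioi (neg_neg_of_pos hz)]
  simp
  field_simp

lemma gaverStehfest_sub_eq_integral {f : ℝ → ℝ} {n : ℕ} (hn : n ≠ 0) {x c : ℝ} (hx : 0 < x)
    (hc : c = Real.log 2 * x⁻¹)
    (hF : ∀ z : ℝ, 0 < z → IntegrableOn (fun t : ℝ => Real.exp (-z * t) * f t) (Ioi (0 : ℝ))) :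
    gaverStehfest f n x - f x =
      ∫ t in Ioi 0, c * gaverStehfestPoly n (Real.exp (-(c * t))) * (f t - f x) := by
  obtain ⟨hi, hv⟩ := gaverStehfest_eq_integral n hx hc hF
  obtain ⟨hi1, hv1⟩ := gaverStehfest_eq_integral (f := fun _ => 1) n hx hc fun z hz => by
    simpa using integrableOn_exp_mul_Ioi (neg_neg_of_pos hz) 0
  rw [gaverStehfest_one hn hx] at hv1
  simp only [mul_one] at hi1 hv1
  simp only [mul_sub]
  rw [integral_sub hi (hi1.mul_const _), integral_mul_const, ← hv, ← hv1, one_mul]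

/-- Taken at a = c(t-x), this bounds |1-2y| below by the distance from t to x, since 2e^{-ct} =
e^{-c(t-x)}. -/
lemma min_abs_div_two_le (a : ℝ) : min |a| 1 / 2 ≤ |1 - Real.exp (-a)| := by
  rcases le_or_gt 0 a with ha | ha
  · have h1 : Real.exp (-a) * (1 + a) ≤ 1 := by
      have h2 : Real.exp (-a) * Real.exp a = 1 := by rw [← Real.exp_add]; simp
      nlinarith [Real.add_one_le_exp a, Real.exp_pos (-a)]
    have h3 : Real.exp (-a) ≤ 1 := by rw [Real.exp_le_one_iff]; linarith
    rw [abs_of_nonneg ha, abs_of_nonneg (by linarith)]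
    rcases le_or_gt a 1 with h | h
    · rw [min_eq_left h]
      nlinarith [Real.exp_pos (-a)]
    · rw [min_eq_right h.le]
      nlinarith [Real.exp_pos (-a)]
  · have h1 := Real.add_one_le_exp (-a)
    rw [abs_of_neg ha, abs_of_nonpos (by linarith)]
    have := min_le_left (-a) 1
    linarith

lemma integrableOn_abs_sub_rpow {s : ℝ} (hs : -1 < s) (x : ℝ) {δ : ℝ} (hδ : 0 < δ) :
    IntegrableOn (fun t : ℝ => |t - x| ^ s) (Metric.ball x δ) := by
  have h1 : IntervalIntegrable (fun u : ℝ => |u| ^ s) volume 0 δ := by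
    refine (intervalIntegral.intervalIntegrable_rpow' hs).congr fun u hu => ?_
    rw [uIoc_of_le hδ.le] at hu
    rw [abs_of_pos hu.1]
  have h2 : IntervalIntegrable (fun u : ℝ => |u| ^ s) volume (-δ) 0 := by
    have := (IntervalIntegrable.iff_comp_neg).mp h1
    simp only [abs_neg, neg_zero] at this
    exact this.symm
  have h3 := (h2.trans h1).comp_sub_right x
  rw [intervalIntegrable_iff_integrableOn_Ioc_of_le (by linarith)] at h3
  refine h3.mono_set ?_
  rw [Real.ball_eq_Ioo]
  intro t ht
  exact ⟨by linarith [ht.1], by linarith [ht.2]⟩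

lemma exists_abs_gaverStehfestPoly_le :
    ∃ C : ℝ, 0 ≤ C ∧ ∀ (n : ℕ), n ≠ 0 → ∀ y : ℝ, 0 < y → y < 1 → y ≠ 1 / 2 →
      |gaverStehfestPoly n y| ≤ C * |1 - 2 * y|⁻¹ := by
  obtain ⟨C, hC, h⟩ := exists_abs_diffMean_centralBinom_le
  refine ⟨C, hC, fun n hn y hy hy1 hy2 => ?_⟩
  have h0 : (1 - 2 * y) ≠ 0 := fun h => hy2 (by linarith)
  have h1 : 0 < (1 - 2 * y) ^ 2 := by positivity
  have := h n hn (1 - (1 - 2 * y) ^ 2) (by nlinarith) (by linarith)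
  rwa [← gaverStehfestPoly_eq, sub_sub_cancel, Real.sqrt_sq_eq_abs] at this

/-- The factor w = 4y(1-y) ≤ 4y is kept: at y = e^{-ct} it supplies the decay needed to integrate f
at infinity. -/
lemma exists_abs_gaverStehfestPoly_le_geometric {d : ℝ} (hd : 0 < d) (hd1 : d < 1) :
    ∃ ρ C : ℝ, 0 ≤ ρ ∧ ρ < 1 ∧ 0 ≤ C ∧ ∀ (m : ℕ) (y : ℝ), 0 ≤ y → y ≤ 1 → d ≤ |1 - 2 * y| →
      |gaverStehfestPoly (m + 1) y| ≤ C * ((m + 1) * ρ ^ m) * y := by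
  obtain ⟨ρ, C, h0, h1, hC, h⟩ := exists_abs_diffMean_centralBinom_le_geometric
    (w₀ := 1 - d ^ 2) (by nlinarith) (by nlinarith)
  refine ⟨ρ, C * 4, h0, h1, by positivity, fun m y hy hy1 hdy => ?_⟩
  have h2 : d ^ 2 ≤ (1 - 2 * y) ^ 2 := by
    rw [← sq_abs (1 - 2 * y)]
    gcongr
  have := h m (1 - (1 - 2 * y) ^ 2) (by nlinarith) (by linarith)
  rw [← gaverStehfestPoly_eq] at this
  refine this.trans ?_
  calc _ ≤ C * ((m + 1) * ρ ^ m) * (4 * y) := by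
        gcongr
        nlinarith
    _ = _ := by ring

/-! ### Convergence by dominated convergence -/

lemma tendsto_succ_mul_pow {ρ : ℝ} (h0 : 0 ≤ ρ) (h1 : ρ < 1) :
    Tendsto (fun m : ℕ => ((m : ℝ) + 1) * ρ ^ m) atTop (𝓝 0) := by
  have := (tendsto_self_mul_const_pow_of_lt_one h0 h1).add (tendsto_pow_atTop_nhds_zero_of_lt_one h0 h1)
  simpa [add_mul] using this

theorem mainTheorem2 (f : ℝ → ℝ)
    (hf : LocallyIntegrableOn f (Ioi (0 : ℝ)))
    (hF : ∀ z : ℝ, 0 < z → IntegrableOn (fun t : ℝ => Real.exp (-z * t) * f t) (Ioi (0 : ℝ)))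
    (x : ℝ) (hx : 0 < x) (α : ℝ) (hα : 0 < α)
    (hHolder : (fun v : ℝ => f (x + v) - f x) =O[𝓝 (0 : ℝ)] (fun v : ℝ => |v| ^ α)) :
    Tendsto (fun n : ℕ => gaverStehfest f n x) atTop (𝓝 (f x)) := by
  obtain ⟨c, hc⟩ : ∃ c, c = Real.log 2 * x⁻¹ := ⟨_, rfl⟩
  have hc0 : 0 < c := hc ▸ mul_pos (Real.log_pos one_lt_two) (inv_pos.mpr hx)
  have hcx : c * x = Real.log 2 := by rw [hc]; field_simp
  have hy : ∀ t, 1 - 2 * Real.exp (-(c * t)) = 1 - Real.exp (-(c * (t - x))) := by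
    intro t
    rw [mul_sub, hcx, neg_sub, sub_eq_add_neg (Real.log 2), Real.exp_add, Real.exp_log two_pos]
  obtain ⟨C₀, hC₀, hHC⟩ := hHolder.exists_pos
  obtain ⟨ε, hε, hHε⟩ := Metric.eventually_nhds_iff.mp hHC.bound
  -- The cap 1/c gives c|t-x| ≤ 1 on the ball, so the minimum in the lower bound for |1-2y| is
  -- c|t-x| there and at least cδ outside.
  set δ := min ε c⁻¹ with hδ
  have hδ0 : 0 < δ := lt_min hε (inv_pos.mpr hc0)
  have hδc : c * δ ≤ 1 := by
    calc c * δ ≤ c * c⁻¹ := by gcongr; exact min_le_right _ _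
      _ = 1 := mul_inv_cancel₀ hc0.ne'
  obtain ⟨C₁, hC₁, hnear⟩ := exists_abs_gaverStehfestPoly_le
  obtain ⟨ρ, C₂, hρ0, hρ1, hC₂, hfar⟩ := exists_abs_gaverStehfestPoly_le_geometric
    (d := c * δ / 2) (by positivity) (by linarith)
  obtain ⟨K, hK⟩ := (tendsto_succ_mul_pow hρ0 hρ1).bddAbove_range
  have hK' : ∀ m : ℕ, ((m : ℝ) + 1) * ρ ^ m ≤ K := fun m => hK ⟨m, rfl⟩
  have hK0 : 0 ≤ K := by simpa using (zero_le_one.trans (by simpa using hK' 0))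
  set g : ℝ → ℝ := fun t => Real.exp (-c * t) * |f t - f x| with hg
  have hgi : IntegrableOn g (Ioi 0) := by
    have h1 := ((hF c hc0).sub
      ((integrableOn_exp_mul_Ioi (neg_neg_of_pos hc0) 0).mul_const (f x))).norm
    refine h1.congr (Eventually.of_forall fun t => ?_)
    simp only [Pi.sub_apply, hg]
    rw [← mul_sub, norm_mul, Real.norm_of_nonneg (Real.exp_pos _).le, Real.norm_eq_abs]
  set A := 2 * C₁ * C₀ with hA
  have hA0 : 0 ≤ A := by positivity
  -- The first term dominates within δ of x and is integrable since α - 1 > -1; the second dominates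
  -- elsewhere and is integrable because the Laplace integral converges at z = c.
  set b : ℝ → ℝ := fun t =>
    (Metric.ball x δ).indicator (fun t => A * |t - x| ^ (α - 1)) t + c * C₂ * K * g t with hb
  have hbi : Integrable b (volume.restrict (Ioi 0)) := by
    refine Integrable.add ?_ (hgi.const_mul _)
    refine Integrable.restrict ?_
    rw [integrable_indicator_iff Metric.isOpen_ball.measurableSet]
    exact (integrableOn_abs_sub_rpow (by linarith) x hδ0).const_mul A
  have hfm : AEStronglyMeasurable f (volume.restrict (Ioi 0)) := hf.aestronglyMeasurable
  have key : Tendsto (fun m : ℕ => ∫ t in Ioi 0,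
      c * gaverStehfestPoly (m + 1) (Real.exp (-(c * t))) * (f t - f x)) atTop
      (𝓝 (∫ t in Ioi (0 : ℝ), (0 : ℝ))) := by
    refine tendsto_integral_of_dominated_convergence b (fun m => ?_) hbi (fun m => ?_) ?_
    · refine AEStronglyMeasurable.mul ?_ (hfm.sub aestronglyMeasurable_const)
      have := continuous_gaverStehfestPoly (m + 1)
      exact Continuous.aestronglyMeasurable (by fun_prop)
    · filter_upwards [ae_restrict_mem measurableSet_Ioi] with t ht
      have ht0 : (0 : ℝ) < t := ht
      have hct : 0 < c * t := by positivity
      have hylt : Real.exp (-(c * t)) < 1 := by rw [Real.exp_lt_one_iff]; linarith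
      have hd := min_abs_div_two_le (c * (t - x))
      rw [← hy, abs_mul, abs_of_pos hc0] at hd
      have hg0 : 0 ≤ c * C₂ * K * g t := by positivity
      have hi0 : 0 ≤ (Metric.ball x δ).indicator (fun t => A * |t - x| ^ (α - 1)) t :=
        indicator_nonneg (fun t _ => by positivity) t
      rw [norm_mul, norm_mul, Real.norm_of_nonneg hc0.le, Real.norm_eq_abs, Real.norm_eq_abs, hb]
      simp only
      by_cases htx : |t - x| < δ
      · refine le_add_of_le_of_nonneg ?_ hg0
        rw [indicator_of_mem (show t ∈ Metric.ball x δ by rwa [Metric.mem_ball, Real.dist_eq])]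
        rcases eq_or_ne t x with rfl | hne
        · simp only [sub_self, abs_zero, mul_zero]
          positivity
        · have hpos : 0 < |t - x| := abs_pos.mpr (sub_ne_zero.mpr hne)
          have h1 : c * |t - x| ≤ 1 := by
            refine le_trans ?_ hδc
            gcongr
          rw [min_eq_left h1] at hd
          have h2 : |gaverStehfestPoly (m + 1) (Real.exp (-(c * t)))| ≤
              C₁ * (c * |t - x| / 2)⁻¹ := by
            refine (hnear (m + 1) m.succ_ne_zero _ (Real.exp_pos _) hylt ?_).trans ?_
            · intro h
              rw [h] at hd
              norm_num at hd
              have : 0 < c * |t - x| := by positivity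
              linarith
            · gcongr
          have h3 : |f t - f x| ≤ C₀ * |t - x| ^ α := by
            have := hHε (y := t - x) (by
              rw [Real.dist_eq, sub_zero]
              exact htx.trans_le (min_le_left _ _))
            rw [add_sub_cancel, Real.norm_eq_abs, Real.norm_of_nonneg (by positivity)] at this
            exact this
          calc _ ≤ c * (C₁ * (c * |t - x| / 2)⁻¹) * (C₀ * |t - x| ^ α) := by gcongr
            _ = A * |t - x| ^ (α - 1) := by
              rw [Real.rpow_sub_one hpos.ne', hA]
              field_simp
      · refine le_add_of_nonneg_of_le hi0 ?_
        have h1 : c * δ ≤ c * |t - x| := by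
          push Not at htx
          gcongr
        have h2 : c * δ / 2 ≤ |1 - 2 * Real.exp (-(c * t))| := by
          refine le_trans ?_ hd
          have := le_min h1 hδc
          linarith
        have h3 := hfar m _ (Real.exp_pos _).le hylt.le h2
        calc _ ≤ c * (C₂ * K * Real.exp (-(c * t))) * |f t - f x| := by
              gcongr
              refine h3.trans ?_
              have := hK' m
              gcongr
          _ = _ := by
              rw [hg]
              simp only [neg_mul]
              ring
    · have hne : ∀ᵐ t ∂(volume.restrict (Ioi (0 : ℝ))), t ≠ x :=
        ae_restrict_of_ae (Measure.ae_ne volume x)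
      filter_upwards [ae_restrict_mem measurableSet_Ioi, hne] with t ht htx
      have ht0 : (0 : ℝ) < t := ht
      have hct : 0 < c * t := by positivity
      have hylt : Real.exp (-(c * t)) < 1 := by rw [Real.exp_lt_one_iff]; linarith
      have hd := min_abs_div_two_le (c * (t - x))
      rw [← hy] at hd
      have hpos : 0 < |c * (t - x)| := abs_pos.mpr (mul_ne_zero hc0.ne' (sub_ne_zero.mpr htx))
      have hmin := min_le_right |c * (t - x)| 1
      have hmin0 : 0 < min |c * (t - x)| 1 := lt_min hpos one_pos
      -- For the pointwise limit, each t ≠ x has its own distance and hence its own geometric rate.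
      obtain ⟨r, C, hr0, hr1, -, hrC⟩ := exists_abs_gaverStehfestPoly_le_geometric
        (d := min |c * (t - x)| 1 / 2) (by linarith) (by linarith)
      have h1 : Tendsto (fun m : ℕ => gaverStehfestPoly (m + 1) (Real.exp (-(c * t)))) atTop
          (𝓝 0) := by
        refine squeeze_zero_norm
          (fun m => hrC m (Real.exp (-(c * t))) (Real.exp_pos _).le hylt.le hd) ?_
        simpa using ((tendsto_succ_mul_pow hr0 hr1).const_mul C).mul_const (Real.exp (-(c * t)))
      simpa using (h1.const_mul c).mul_const (f t - f x)
  rw [← tendsto_add_atTop_iff_nat 1, ← tendsto_sub_nhds_zero_iff]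
  simp only [integral_zero] at key
  refine key.congr fun m => ?_
  exact (gaverStehfest_sub_eq_integral m.succ_ne_zero hx hc hF).symm
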